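/- Bit complexity is measured on a random access machine under the logarithmic cost criterion: memory cells hold integers, the primitive operations are assignment, addition, subtraction, shifts, bit length, indirect load and store, tests, loops and (recursive) procedure calls, each charged one plus the bit lengths of the integers it handles (plus the shift distance for left shifts); there is no primitive multiplication. Let $M(n)$ be the cost of multiplying two $n$-bit integers, i.e. let some program multiply any two nonnegative $n$-bit integers in at most $M(n)$ bit operations for every $n\ge 1$, where $M$ is, as usual, superadditive: $M(a)+M(b)\le M(a+b)$ for $a,b\ge 1$. Consider the following self-correcting algorithm. On input of a positive integer $n$, put $\alpha_0=3$ and $m=\lceil\log_3 n\rceil$; for $k=1,\dots,m$ compute $\alpha_k=\alpha_{k-1}+\sin\alpha_{k-1}$ with $3^k$-bit precision, i.e. let $\alpha_k$ be a number with $3^k$ fractional bits such that $|\alpha_k-(\alpha_{k-1}+\sin\alpha_{k-1})|\le\frac34\cdot 2^{-3^k}$; return $\alpha_m$. (i) However the step $(p,x)\mapsto x+\sin x$ (for $x$ with $p\ge1$ fractional bits and $|\pi-x|<1$, the result having $3p$ fractional bits and error at most $\frac34\cdot2^{-3p}$) is implemented, the algorithm halts for every $n\ge1$ and $|\pi-\alpha_m|<2^{-n}$.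 (ii) The step can be implemented by a program such that the algorithm runs in $O(M(n)\log^2 n)$ bit operations: there is a constant $C$ such that for every $n\ge2$ the algorithm takes at most $C\,M(n)\log^2 n$ bit operations (and returns $\alpha_m$ with $|\pi-\alpha_m|<2^{-n}$). -/

import Mathlib

/-! Bit complexity is measured on a random access machine under the logarithmic cost criterion,
programmed in structured form: memory cells hold integers of arbitrary size, and every operation is
charged the total bit length of the integers (operands, results, computed addresses) it handles.
There is no multiplication instruction: products have to be computed by programs. -/

namespace BitRAM

/-- The memory: cell `i` holds an integer. -/
abbrev Mem := ℕ → ℤ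

/-- Number of binary digits of `|z|`. -/
def bits (z : ℤ) : ℕ := Nat.size z.natAbs

/-- Programs. Natural number arguments are (fixed) cells, `d` being the target. -/
inductive Prog : Type
  /-- do nothing -/
  | skip : Prog
  /-- `d := c` -/
  | const (d : ℕ) (c : ℤ) : Prog
  /-- `d := a` -/
  | move (d a : ℕ) : Prog
  /-- `d := a + b` -/
  | add (d a b : ℕ) : Prog
  /-- `d := a - b` -/
  | sub (d a b : ℕ) : Prog
  /-- `d := a * 2 ^ b` (a left shift by `b` places) -/
  | shl (d a b : ℕ) : Prog
  /-- `d := ⌊a / 2 ^ b⌋` (a right shift by `b` places) -/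
  | shr (d a b : ℕ) : Prog
  /-- `d :=` the bit length of `a` -/
  | len (d a : ℕ) : Prog
  /-- `d :=` content of the cell whose address is in `a` -/
  | load (d a : ℕ) : Prog
  /-- the cell whose address is in `a` receives the content of `b` -/
  | store (a b : ℕ) : Prog
  /-- first `p`, then `q` -/
  | seq (p q : Prog) : Prog
  /-- if `0 < a` then `p` else `q` -/
  | ifPos (a : ℕ) (p q : Prog) : Prog
  /-- while `0 < a` do `p` -/
  | loop (a : ℕ) (p : Prog) : Prog
  /-- run `p` as a procedure, in a memory of its own that holds the contents of `args` in the cells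
  `0, 1, …` and is zero elsewhere; copy its final cells `0, 1, …` to `dsts` -/
  | call (dsts : List ℕ) (p : Prog) (args : List ℕ) : Prog
  /-- recursive call, in the same manner, of the procedure that is being executed -/
  | recur (dsts : List ℕ) (args : List ℕ) : Prog

/-- Initial memory of a procedure. -/
def frame (args : List ℤ) : Mem := fun i => args.getD i 0

/-- Copy the cells `i, i + 1, …` of `τ` to the cells `dsts` of `σ`. -/
def copyOut : List ℕ → ℕ → Mem → Mem → Mem
  | [], _, _, σ => σ
  | d :: ds, i, τ, σ => copyOut ds (i + 1) τ (Function.update σ d (τ i))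

/-- Cost of passing arguments from `σ` and results from `τ`. -/
def passCost (dsts args : List ℕ) (σ τ : Mem) : ℕ :=
  (args.map fun a => bits (σ a)).sum + ((List.range dsts.length).map fun i => bits (τ i)).sum

/-- `Exec self p σ τ t`: inside the procedure `self`, executing `p` from memory `σ` terminates in
memory `τ` after `t` bit operations. -/
inductive Exec : Prog → Prog → Mem → Mem → ℕ → Prop
  | skip (s : Prog) (σ : Mem) : Exec s .skip σ σ 1
  | const (s : Prog) (d : ℕ) (c : ℤ) (σ : Mem) :
      Exec s (.const d c) σ (Function.update σ d c) (1 + bits c)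
  | move (s : Prog) (d a : ℕ) (σ : Mem) :
      Exec s (.move d a) σ (Function.update σ d (σ a)) (1 + bits (σ a))
  | add (s : Prog) (d a b : ℕ) (σ : Mem) :
      Exec s (.add d a b) σ (Function.update σ d (σ a + σ b)) (1 + bits (σ a) + bits (σ b))
  | sub (s : Prog) (d a b : ℕ) (σ : Mem) :
      Exec s (.sub d a b) σ (Function.update σ d (σ a - σ b)) (1 + bits (σ a) + bits (σ b))
  | shl (s : Prog) (d a b : ℕ) (σ : Mem) :
      Exec s (.shl d a b) σ (Function.update σ d (σ a * 2 ^ (σ b).toNat))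
        (1 + bits (σ a) + bits (σ b) + (σ b).toNat)
  | shr (s : Prog) (d a b : ℕ) (σ : Mem) :
      Exec s (.shr d a b) σ (Function.update σ d (σ a / 2 ^ (σ b).toNat))
        (1 + bits (σ a) + bits (σ b))
  | len (s : Prog) (d a : ℕ) (σ : Mem) :
      Exec s (.len d a) σ (Function.update σ d (bits (σ a) : ℤ)) (1 + bits (σ a))
  | load (s : Prog) (d a : ℕ) (σ : Mem) :
      Exec s (.load d a) σ (Function.update σ d (σ (σ a).toNat))
        (1 + bits (σ a) + bits (σ (σ a).toNat))
  | store (s : Prog) (a b : ℕ) (σ : Mem) :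
      Exec s (.store a b) σ (Function.update σ (σ a).toNat (σ b)) (1 + bits (σ a) + bits (σ b))
  | seq {s p q : Prog} {σ τ ρ : Mem} {t u : ℕ} :
      Exec s p σ τ t → Exec s q τ ρ u → Exec s (.seq p q) σ ρ (t + u)
  | ifTrue {s p q : Prog} {a : ℕ} {σ τ : Mem} {t : ℕ} :
      0 < σ a → Exec s p σ τ t → Exec s (.ifPos a p q) σ τ (1 + bits (σ a) + t)
  | ifFalse {s p q : Prog} {a : ℕ} {σ τ : Mem} {t : ℕ} :
      ¬ 0 < σ a → Exec s q σ τ t → Exec s (.ifPos a p q) σ τ (1 + bits (σ a) + t)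
  | loopStep {s p : Prog} {a : ℕ} {σ τ ρ : Mem} {t u : ℕ} :
      0 < σ a → Exec s p σ τ t → Exec s (.loop a p) τ ρ u →
        Exec s (.loop a p) σ ρ (1 + bits (σ a) + t + u)
  | loopDone {s p : Prog} {a : ℕ} {σ : Mem} :
      ¬ 0 < σ a → Exec s (.loop a p) σ σ (1 + bits (σ a))
  | call {s p : Prog} {dsts args : List ℕ} {σ τ : Mem} {t : ℕ} :
      Exec p p (frame (args.map σ)) τ t →
        Exec s (.call dsts p args) σ (copyOut dsts 0 τ σ) (1 + passCost dsts args σ τ + t)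
  | recur {s : Prog} {dsts args : List ℕ} {σ τ : Mem} {t : ℕ} :
      Exec s s (frame (args.map σ)) τ t →
        Exec s (.recur dsts args) σ (copyOut dsts 0 τ σ) (1 + passCost dsts args σ τ + t)

/-- Execution is deterministic: the final memory and the number of bit operations are unique. -/
theorem Exec.unique {s p : Prog} {σ τ τ' : Mem} {t t' : ℕ} (h : Exec s p σ τ t)
    (h' : Exec s p σ τ' t') : τ = τ' ∧ t = t' := by
  induction h generalizing τ' t' with
  | skip | const | move | add | sub | shl | shr | len | load | store =>
    cases h'
    exact ⟨rfl, rfl⟩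
  | seq _ _ ih₁ ih₂ =>
    cases h' with
    | seq k₁ k₂ =>
      obtain ⟨rfl, rfl⟩ := ih₁ k₁
      obtain ⟨rfl, rfl⟩ := ih₂ k₂
      exact ⟨rfl, rfl⟩
  | ifTrue hc _ ih =>
    cases h' with
    | ifTrue _ k =>
      obtain ⟨rfl, rfl⟩ := ih k
      exact ⟨rfl, rfl⟩
    | ifFalse hn _ => exact absurd hc hn
  | ifFalse hc _ ih =>
    cases h' with
    | ifTrue hn _ => exact absurd hn hc
    | ifFalse _ k =>
      obtain ⟨rfl, rfl⟩ := ih k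
      exact ⟨rfl, rfl⟩
  | loopStep hc _ _ ih₁ ih₂ =>
    cases h' with
    | loopStep _ k₁ k₂ =>
      obtain ⟨rfl, rfl⟩ := ih₁ k₁
      obtain ⟨rfl, rfl⟩ := ih₂ k₂
      exact ⟨rfl, rfl⟩
    | loopDone hn => exact absurd hc hn
  | loopDone hc =>
    cases h' with
    | loopStep hn _ _ => exact absurd hn hc
    | loopDone _ => exact ⟨rfl, rfl⟩
  | call _ ih =>
    cases h' with
    | call k =>
      obtain ⟨rfl, rfl⟩ := ih k
      exact ⟨rfl, rfl⟩
  | recur _ ih =>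
    cases h' with
    | recur k =>
      obtain ⟨rfl, rfl⟩ := ih k
      exact ⟨rfl, rfl⟩

/-- On the given input (in the cells `0, 1, …`, all others being zero), `p` halts with `out` in
cell `0` after exactly `t` bit operations. -/
def Runs (p : Prog) (input : List ℤ) (out : ℤ) (t : ℕ) : Prop :=
  ∃ τ : Mem, Exec p p (frame input) τ t ∧ τ 0 = out

/-- `mul` multiplies any two `n`-bit (nonnegative) integers in at most `M n` bit operations. -/
def MultipliesWithin (mul : Prog) (M : ℕ → ℝ) : Prop :=
  ∀ n : ℕ, 1 ≤ n → ∀ a b : ℕ, a < 2 ^ n → b < 2 ^ n →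
    ∃ t : ℕ, Runs mul [(a : ℤ), (b : ℤ)] ((a : ℤ) * (b : ℤ)) t ∧ (t : ℝ) ≤ M n

/-- The number with `p` fractional bits that is stored as the integer `a`. -/
noncomputable def fixedPoint (p : ℕ) (a : ℤ) : ℝ := (a : ℝ) / 2 ^ p

/-- `step` is a procedure for `x ↦ x + sin x` near `π` at tripled precision: given `p` and
`x = a / 2 ^ p` with `|π - x| < 1`, it computes `x + sin x` with `3 * p`-bit precision, that is, it
returns a number with `3 * p` fractional bits that is within `3 / 4` of a unit in the last place
of `x + sin x` (half a unit for rounding an approximation to `3 * p` fractional bits, a quarter of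
a unit for the error of that approximation). -/
def IsSelfCorrectingStep (step : Prog) : Prop :=
  ∀ p : ℕ, 1 ≤ p → ∀ a : ℤ, |Real.pi - fixedPoint p a| < 1 →
    ∃ (b : ℤ) (t : ℕ), Runs step [(p : ℤ), a] b t ∧
      |fixedPoint (3 * p) b - (fixedPoint p a + Real.sin (fixedPoint p a))|
        ≤ 3 / 4 * (1 / 2 ^ (3 * p))

/-- The self-correcting computation of `π`. Cell `0` holds the input `n`, cell `1` the current
precision `p = 3 ^ k`, cell `2` the integer `α_k * 2 ^ p` and cell `3` the difference `n - p`.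
Start with `k = 0` and `α_0 = 3 = 6 / 2 ^ 1`; as long as `3 ^ k < n` (so `m = ⌈log₃ n⌉` times),
compute `α_{k+1} = α_k + sin α_k` with `3 ^ (k + 1)`-bit precision by the procedure `step`;
return `α_m`. -/
def selfCorrectingPi (step : Prog) : Prog :=
  .seq (.const 1 1) <|
  .seq (.const 2 6) <|
  .seq (.sub 3 0 1) <|
  .seq
    (.loop 3 <|
      .seq (.call [2] step [1, 2]) <|
      .seq (.add 4 1 1) <|
      .seq (.add 1 4 1) <|
      .sub 3 0 1) <|
  .move 0 2

end BitRAM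

/-!
Write `x = π + δ`. Then `x + sin x = π + (δ - sin δ)` and `|δ - sin δ| ≤ |δ| ^ 3 / 6`, so one step at
tripled precision `3 * p` turns an error below `2 ^ (-p)` into one below
`(1 / 6 + 3 / 4) * 2 ^ (-3 * p)` (`abs_pi_sub_lt_of_step`). Together with `|π - 3| < 1 / 2` this gives
the correctness of the iteration for every implementation of the step
(`exists_runs_selfCorrectingPi`).

For the running time, the step has to evaluate the sine with `O(p)` bits in `O(M(p) log² p)` bit
operations. The program `sineStep` does so by bit bursts: `x / 8` is written as a sum of `O(log p)`
numbers `r = m / 2 ^ e` with `m < 2 ^ (e - h)` and `e ≤ 2 * h + 1`, and `exp (i x / 8)` is the product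
of the numbers `exp (i r)` (`wp_burstLoop`). As `r < 2 ^ (-h)` has only `e` bits, the number of terms
of the exponential series that are needed is so small that the total length of numerator and
denominator of the partial sum is `O(p)` (`splitWeight_le`); binary splitting therefore costs
`O(M(p))` on each of its `O(log p)` levels (`FastMul.binarySplit`), and the division by `O(log p)`
Newton steps at full precision costs `O(M(p) log p)` as well (`exists_reciprocal`). Eighth power and
rounding finish the step (`exists_sineStep`).

Superadditivity of `M` gives no upper bound for `M(c * p)` in terms of `M(p)`. Hence all
multiplications of numbers with at most `1024 * p` bits are reduced to the given program for numbers
of at most `p` bits, by cutting the factors into a bounded number of pieces. The resulting cost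
function is again superadditive (`exists_fastMul`), which is what the analysis of binary splitting
needs. Since step `k` uses the precision `3 ^ k < n`, superadditivity bounds the total cost of all
steps by a constant multiple of `M(n) log² n`.

Programs are verified by symbolic execution: the predicate `Wp` is computed by the simplifier on
memories of the form `frame [x₀, x₁, …]`, with the clock running along.
-/

set_option linter.unusedSimpArgs false
set_option linter.flexible false

namespace BitRAM

/-! ### Program logic -/

section ProgramLogic

/-- Weakest precondition with a running clock: inside the procedure `s`, the program `p` started
in memory `σ` when `c` bit operations have been spent terminates with a memory and a total number
of bit operations that satisfy `Q`. -/
def Wp (s p : Prog) (σ : Mem) (c : ℕ) (Q : Mem → ℕ → Prop) : Prop :=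
  ∃ τ t, Exec s p σ τ t ∧ Q τ (c + t)

/-- On the arguments `ins`, the procedure `p` terminates within `T` bit operations, and its first
cells then hold `outs`. -/
def Computes (p : Prog) (ins outs : List ℤ) (T : ℕ) : Prop :=
  ∃ τ t, Exec p p (frame ins) τ t ∧ t ≤ T ∧ ∀ i < outs.length, τ i = frame outs i

variable {s p q : Prog} {σ : Mem} {c T : ℕ} {Q : Mem → ℕ → Prop}

theorem Wp.computes {ins outs : List ℤ}
    (h : Wp p p (frame ins) 0 fun τ t => t ≤ T ∧ ∀ i < outs.length, τ i = frame outs i) :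
    Computes p ins outs T := by
  obtain ⟨τ, t, h₁, h₂, h₃⟩ := h
  exact ⟨τ, t, h₁, by omega, h₃⟩

/-- For a procedure without recursive calls the name `s` of the surrounding procedure is immaterial;
keeping it abstract keeps the goals small. -/
theorem Wp.computes_of_forall {ins outs : List ℤ}
    (h : ∀ s, Wp s p (frame ins) 0 fun τ t => t ≤ T ∧ ∀ i < outs.length, τ i = frame outs i) :
    Computes p ins outs T :=
  (h p).computes

theorem Computes.mono {ins outs : List ℤ} {T' : ℕ} (h : Computes p ins outs T) (hT : T ≤ T') :
    Computes p ins outs T' := by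
  obtain ⟨τ, t, h₁, h₂, h₃⟩ := h
  exact ⟨τ, t, h₁, h₂.trans hT, h₃⟩

@[simp] theorem wp_const {d : ℕ} {z : ℤ} :
    Wp s (.const d z) σ c Q ↔ Q (Function.update σ d z) (c + (1 + bits z)) :=
  ⟨fun ⟨_, _, h, hq⟩ => by cases h; exact hq, fun h => ⟨_, _, .const .., h⟩⟩

@[simp] theorem wp_move {d a : ℕ} :
    Wp s (.move d a) σ c Q ↔ Q (Function.update σ d (σ a)) (c + (1 + bits (σ a))) :=
  ⟨fun ⟨_, _, h, hq⟩ => by cases h; exact hq, fun h => ⟨_, _, .move .., h⟩⟩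

@[simp] theorem wp_add {d a b : ℕ} :
    Wp s (.add d a b) σ c Q ↔
      Q (Function.update σ d (σ a + σ b)) (c + (1 + bits (σ a) + bits (σ b))) :=
  ⟨fun ⟨_, _, h, hq⟩ => by cases h; exact hq, fun h => ⟨_, _, .add .., h⟩⟩

@[simp] theorem wp_sub {d a b : ℕ} :
    Wp s (.sub d a b) σ c Q ↔
      Q (Function.update σ d (σ a - σ b)) (c + (1 + bits (σ a) + bits (σ b))) :=
  ⟨fun ⟨_, _, h, hq⟩ => by cases h; exact hq, fun h => ⟨_, _, .sub .., h⟩⟩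

@[simp] theorem wp_shl {d a b : ℕ} :
    Wp s (.shl d a b) σ c Q ↔
      Q (Function.update σ d (σ a * 2 ^ (σ b).toNat))
        (c + (1 + bits (σ a) + bits (σ b) + (σ b).toNat)) :=
  ⟨fun ⟨_, _, h, hq⟩ => by cases h; exact hq, fun h => ⟨_, _, .shl .., h⟩⟩

@[simp] theorem wp_shr {d a b : ℕ} :
    Wp s (.shr d a b) σ c Q ↔
      Q (Function.update σ d (σ a / 2 ^ (σ b).toNat)) (c + (1 + bits (σ a) + bits (σ b))) :=
  ⟨fun ⟨_, _, h, hq⟩ => by cases h; exact hq, fun h => ⟨_, _, .shr .., h⟩⟩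

@[simp] theorem wp_len {d a : ℕ} :
    Wp s (.len d a) σ c Q ↔ Q (Function.update σ d (bits (σ a) : ℤ)) (c + (1 + bits (σ a))) :=
  ⟨fun ⟨_, _, h, hq⟩ => by cases h; exact hq, fun h => ⟨_, _, .len .., h⟩⟩

@[simp] theorem wp_seq : Wp s (.seq p q) σ c Q ↔ Wp s p σ c fun τ t => Wp s q τ t Q := by
  constructor
  · rintro ⟨_, _, h, hq⟩
    cases h with
    | seq h₁ h₂ => exact ⟨_, _, h₁, _, _, h₂, by rwa [Nat.add_assoc]⟩
  · rintro ⟨_, _, h₁, _, _, h₂, hq⟩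
    exact ⟨_, _, .seq h₁ h₂, by rwa [← Nat.add_assoc]⟩

theorem Wp.ifPos {a : ℕ} (h₁ : 0 < σ a → Wp s p σ (c + (1 + bits (σ a))) Q)
    (h₂ : σ a ≤ 0 → Wp s q σ (c + (1 + bits (σ a))) Q) : Wp s (.ifPos a p q) σ c Q := by
  by_cases ha : 0 < σ a
  · obtain ⟨τ, t, h, hq⟩ := h₁ ha
    exact ⟨τ, _, .ifTrue ha h, by rwa [← Nat.add_assoc]⟩
  · obtain ⟨τ, t, h, hq⟩ := h₂ (not_lt.1 ha)
    exact ⟨τ, _, .ifFalse ha h, by rwa [← Nat.add_assoc]⟩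

/-- Total correctness of a loop: `I k τ t` is the invariant when `k` iterations remain, with
memory `τ` and clock `t`. -/
theorem Wp.loop {a : ℕ} (I : ℕ → Mem → ℕ → Prop)
    (step : ∀ k τ t, I (k + 1) τ t → 0 < τ a ∧ Wp s p τ (t + (1 + bits (τ a))) (I k))
    (done : ∀ τ t, I 0 τ t → τ a ≤ 0 ∧ Q τ (t + (1 + bits (τ a)))) :
    ∀ (k : ℕ) (σ : Mem) (c : ℕ), I k σ c → Wp s (.loop a p) σ c Q := by
  intro k
  induction k with
  | zero =>
    intro σ c h
    obtain ⟨h₁, h₂⟩ := done _ _ h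
    exact ⟨_, _, .loopDone (not_lt.2 h₁), h₂⟩
  | succ k ih =>
    intro σ c h
    obtain ⟨h₁, τ, t, h₂, h₃⟩ := step _ _ _ h
    obtain ⟨ρ, u, h₄, h₅⟩ := ih _ _ h₃
    refine ⟨ρ, _, .loopStep h₁ h₂ h₄, ?_⟩
    convert h₅ using 1
    omega

@[simp] theorem copyOut_nil (i : ℕ) (τ σ : Mem) : copyOut [] i τ σ = σ := rfl

@[simp] theorem copyOut_cons (d : ℕ) (ds : List ℕ) (i : ℕ) (τ σ : Mem) :
    copyOut (d :: ds) i τ σ = copyOut ds (i + 1) τ (Function.update σ d (τ i)) := rfl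

theorem copyOut_congr {τ τ' : Mem} (dsts : List ℕ) (i : ℕ) (σ : Mem)
    (h : ∀ j < dsts.length, τ (i + j) = τ' (i + j)) :
    copyOut dsts i τ σ = copyOut dsts i τ' σ := by
  induction dsts generalizing i σ with
  | nil => rfl
  | cons d ds ih =>
    have h0 := h 0 (by simp)
    simp only [Nat.add_zero] at h0
    simp only [copyOut, h0]
    refine ih _ _ fun j hj => ?_
    have := h (j + 1) (by simpa using hj)
    rwa [show i + (j + 1) = i + 1 + j by ring] at this

theorem passCost_congr {τ τ' : Mem} (dsts args : List ℕ) (σ : Mem)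
    (h : ∀ j < dsts.length, τ j = τ' j) : passCost dsts args σ τ = passCost dsts args σ τ' := by
  unfold passCost
  congr 2
  refine List.map_congr_left fun j hj => ?_
  rw [h j (List.mem_range.1 hj)]

/-- A call with the arguments `ins` and the results `outs` acts as if the final memory of the callee
were `frame outs`. -/
theorem Wp.call {dsts args : List ℕ} {ins outs : List ℤ} (h : Computes p ins outs T)
    (hi : args.map σ = ins) (hd : dsts.length ≤ outs.length)
    (hQ : ∀ t ≤ T, Q (copyOut dsts 0 (frame outs) σ)
      (c + (1 + passCost dsts args σ (frame outs) + t))) :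
    Wp s (.call dsts p args) σ c Q := by
  subst hi
  obtain ⟨τ, t, h₁, h₂, h₃⟩ := h
  refine ⟨_, _, .call h₁, ?_⟩
  rw [copyOut_congr dsts 0 σ (τ' := frame outs) fun j hj => by simpa using h₃ j (by omega),
    passCost_congr dsts args σ (τ' := frame outs) fun j hj => h₃ j (by omega)]
  exact hQ t h₂

theorem Wp.recur {dsts args : List ℕ} {ins outs : List ℤ} (h : Computes s ins outs T)
    (hi : args.map σ = ins) (hd : dsts.length ≤ outs.length)
    (hQ : ∀ t ≤ T, Q (copyOut dsts 0 (frame outs) σ)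
      (c + (1 + passCost dsts args σ (frame outs) + t))) :
    Wp s (.recur dsts args) σ c Q := by
  subst hi
  obtain ⟨τ, t, h₁, h₂, h₃⟩ := h
  refine ⟨_, _, .recur h₁, ?_⟩
  rw [copyOut_congr dsts 0 σ (τ' := frame outs) fun j hj => by simpa using h₃ j (by omega),
    passCost_congr dsts args σ (τ' := frame outs) fun j hj => h₃ j (by omega)]
  exact hQ t h₂

/-- Explicit zero cells make room for the local variables of a program. -/
theorem frame_pad (l : List ℤ) (k : ℕ) : frame l = frame (l ++ List.replicate k 0) := by
  funext i
  simp only [frame, List.getD_eq_getElem?_getD, List.getElem?_append]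
  split_ifs with h
  · rfl
  · rw [List.getElem?_eq_none (by omega), List.getElem?_replicate]
    split_ifs <;> rfl

@[simp] theorem update_frame (l : List ℤ) (d : ℕ) (z : ℤ) (h : d < l.length) :
    Function.update (frame l) d z = frame (l.set d z) := by
  funext i
  simp only [frame, List.getD_eq_getElem?_getD, List.getElem?_set, Function.update_apply]
  by_cases hi : i = d
  · subst hi; simp [h]
  · simp [hi, Ne.symm hi]

@[simp] theorem frame_zero (x : ℤ) (l : List ℤ) : frame (x :: l) 0 = x := rfl

@[simp] theorem frame_succ (x : ℤ) (l : List ℤ) (i : ℕ) : frame (x :: l) (i + 1) = frame l i := by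
  simp [frame]

end ProgramLogic

/-! ### Bit lengths -/

theorem bits_le {z : ℤ} {n : ℕ} : bits z ≤ n ↔ |z| < 2 ^ n := by
  rw [bits, Nat.size_le, Int.abs_eq_natAbs]
  exact_mod_cast Iff.rfl

theorem abs_lt_two_pow_bits (z : ℤ) : |z| < 2 ^ bits z := bits_le.1 le_rfl

theorem bits_mono {x y : ℤ} (h : |x| ≤ |y|) : bits x ≤ bits y :=
  bits_le.2 (h.trans_lt (abs_lt_two_pow_bits y))

@[simp] theorem bits_zero : bits 0 = 0 := rfl

@[simp] theorem bits_one : bits 1 = 1 := by decide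

@[simp] theorem bits_neg (z : ℤ) : bits (-z) = bits z := by simp [bits]

theorem bits_add_le {x y : ℤ} {n : ℕ} (hx : bits x ≤ n) (hy : bits y ≤ n) :
    bits (x + y) ≤ n + 1 := by
  rw [bits_le] at *
  have := abs_add_le x y
  rw [pow_succ]; linarith

theorem bits_sub_le {x y : ℤ} {n : ℕ} (hx : bits x ≤ n) (hy : bits y ≤ n) :
    bits (x - y) ≤ n + 1 := by
  rw [sub_eq_add_neg]
  exact bits_add_le hx (by rwa [bits_neg])

theorem bits_mul_le (x y : ℤ) : bits (x * y) ≤ bits x + bits y := by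
  rw [bits_le, abs_mul, pow_add]
  exact mul_lt_mul'' (abs_lt_two_pow_bits x) (abs_lt_two_pow_bits y) (abs_nonneg _) (abs_nonneg _)

theorem bits_mul_two_pow_le (x : ℤ) (k : ℕ) : bits (x * 2 ^ k) ≤ bits x + k := by
  rw [bits_le, abs_mul, pow_add, abs_of_pos (by positivity : (0 : ℤ) < 2 ^ k)]
  exact mul_lt_mul_of_pos_right (abs_lt_two_pow_bits x) (by positivity)

theorem bits_natCast_le (n : ℕ) : bits (n : ℤ) ≤ n := by
  rw [bits_le, abs_of_nonneg (by positivity)]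
  exact_mod_cast n.lt_two_pow_self

theorem bits_natCast_mono {m n : ℕ} (h : m ≤ n) : bits (m : ℤ) ≤ bits (n : ℤ) :=
  bits_mono (by rw [abs_of_nonneg (by positivity), abs_of_nonneg (by positivity)]; exact_mod_cast h)

theorem bits_nonneg_mono {x y : ℤ} (hx : 0 ≤ x) (h : x ≤ y) : bits x ≤ bits y :=
  bits_mono (by rwa [abs_of_nonneg hx, abs_of_nonneg (hx.trans h)])

/-- Floor division by a power of two rounds towards `-∞`, so the quotient of a number of absolute
value at most `B * 2 ^ k` has absolute value at most `B`. -/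
theorem abs_ediv_two_pow_le {x : ℤ} {k : ℕ} {B : ℤ} (h : |x| ≤ B * 2 ^ k) :
    |x / 2 ^ k| ≤ B := by
  have hk : (0 : ℤ) < 2 ^ k := by positivity
  rw [abs_le] at *
  constructor
  · rw [Int.le_ediv_iff_mul_le hk]; linarith
  · have := Int.ediv_le_ediv hk h.2
    rwa [Int.mul_ediv_cancel _ hk.ne'] at this

theorem bits_ediv_le (x : ℤ) (k : ℕ) : bits (x / 2 ^ k) ≤ bits x := by
  have h1 : (1 : ℤ) ≤ 2 ^ k := one_le_pow₀ (by norm_num)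
  refine bits_mono (abs_ediv_two_pow_le ?_)
  nlinarith [abs_nonneg x]

/-! ### Multiplication with smaller block size -/

/-- `q` multiplies any two nonnegative `n`-bit integers within `F n` bit operations, `n ≥ 1`. -/
def MultipliesNat (q : Prog) (F : ℕ → ℕ) : Prop :=
  ∀ n : ℕ, 1 ≤ n → ∀ a b : ℤ, 0 ≤ a → a < 2 ^ n → 0 ≤ b → b < 2 ^ n →
    Computes q [a, b] [a * b] (F n)

/-- Multiplication of nonnegative integers `a`, `b` by four multiplications, performed by `q`, of
numbers with about half as many bits: both are split at the position `h = ⌈l / 2⌉`, where `l` is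
the bit length of `a + b`. -/
def halvedMul (q : Prog) : Prog :=
  .seq (.add 2 0 1) <|
  .seq (.len 2 2) <|
  .seq (.const 3 1) <|
  .seq (.add 2 2 3) <|
  .seq (.shr 2 2 3) <|
  .seq (.shr 3 0 2) <|
  .seq (.shl 4 3 2) <|
  .seq (.sub 4 0 4) <|
  .seq (.shr 5 1 2) <|
  .seq (.shl 6 5 2) <|
  .seq (.sub 6 1 6) <|
  .seq (.call [7] q [3, 5]) <|
  .seq (.call [8] q [3, 6]) <|
  .seq (.call [9] q [4, 5]) <|
  .seq (.call [10] q [4, 6]) <|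
  .seq (.shl 7 7 2) <|
  .seq (.add 7 7 8) <|
  .seq (.add 7 7 9) <|
  .seq (.shl 7 7 2) <|
  .add 0 7 10

theorem multipliesNat_halvedMul {q : Prog} {F : ℕ → ℕ} (hq : MultipliesNat q F) :
    MultipliesNat (halvedMul q) fun n => 4 * F (n / 2 + 1) + 400 * n := by
  intro n hn a b ha0 ha hb0 hb
  have hba : bits a ≤ n := bits_le.2 (by rwa [abs_of_nonneg ha0])
  have hbb : bits b ≤ n := bits_le.2 (by rwa [abs_of_nonneg hb0])
  have hs := bits_add_le hba hbb
  obtain ⟨l, hl⟩ : ∃ l, bits (a + b) = l := ⟨_, rfl⟩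
  obtain ⟨h, hh⟩ : ∃ h, (l + 1) / 2 = h := ⟨_, rfl⟩
  have hhz : ((l : ℤ) + 1) / 2 = (h : ℤ) := by omega
  have hab : a + b < 2 ^ l := by
    have := abs_lt_two_pow_bits (a + b)
    rwa [abs_of_nonneg (by positivity), hl] at this
  have hlh : (2 : ℤ) ^ l ≤ 2 ^ h * 2 ^ h := by
    rw [← pow_add]; exact pow_le_pow_right₀ (by norm_num) (by omega)
  have hph : (0 : ℤ) < 2 ^ h := by positivity
  have hhn : (2 : ℤ) ^ h ≤ 2 ^ (n / 2 + 1) := pow_le_pow_right₀ (by norm_num) (by omega)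
  -- the two halves of a factor
  have split : ∀ x : ℤ, 0 ≤ x → x < 2 ^ l → ∃ x₁ x₀ : ℤ, x / 2 ^ h = x₁ ∧ x - x₁ * 2 ^ h = x₀ ∧
      0 ≤ x₁ ∧ x₁ < 2 ^ h ∧ 0 ≤ x₀ ∧ x₀ < 2 ^ h := by
    intro x hx0 hx
    refine ⟨_, _, rfl, rfl, Int.ediv_nonneg hx0 hph.le, ?_, ?_, ?_⟩
    · exact Int.ediv_lt_of_lt_mul hph (hx.trans_le hlh)
    · have := Int.ediv_mul_le x hph.ne'; linarith
    · have := Int.lt_ediv_add_one_mul_self x hph; linarith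
  obtain ⟨a₁, a₀, ha₁, ha₀, ha1, ha2, ha3, ha4⟩ := split a ha0 (by linarith)
  obtain ⟨b₁, b₀, hb₁, hb₀, hb1, hb2, hb3, hb4⟩ := split b hb0 (by linarith)
  have hbh : ∀ x : ℤ, 0 ≤ x → x < 2 ^ h → bits x ≤ h := fun x h0 h1 =>
    bits_le.2 (by rwa [abs_of_nonneg h0])
  have hbl : bits (l : ℤ) ≤ n + 1 := (bits_natCast_le l).trans (by omega)
  have hbl1 : bits ((l : ℤ) + 1) ≤ n + 2 := bits_add_le hbl (by rw [bits_one]; omega)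
  have hbhh : bits (h : ℤ) ≤ n := (bits_natCast_le h).trans (by omega)
  have hc := hq (n / 2 + 1) (by omega)
  refine Wp.computes_of_forall fun s => ?_
  rw [frame_pad _ 9]
  simp [halvedMul, hl, hhz, ha₁, ha₀, hb₁, hb₀]
  refine Wp.call (hc _ _ ha1 (by linarith) hb1 (by linarith)) rfl le_rfl fun t₁ ht₁ => ?_
  simp [passCost]
  refine Wp.call (hc _ _ ha1 (by linarith) hb3 (by linarith)) rfl le_rfl fun t₂ ht₂ => ?_
  simp [passCost]
  refine Wp.call (hc _ _ ha3 (by linarith) hb1 (by linarith)) rfl le_rfl fun t₃ ht₃ => ?_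
  simp [passCost]
  refine Wp.call (hc _ _ ha3 (by linarith) hb3 (by linarith)) rfl le_rfl fun t₄ ht₄ => ?_
  simp [passCost]
  have ha1b := hbh _ ha1 ha2
  have ha0b := hbh _ ha3 ha4
  have hb1b := hbh _ hb1 hb2
  have hb0b := hbh _ hb3 hb4
  have e₁ := bits_mul_le a₁ b₁
  have e₂ := bits_mul_le a₁ b₀
  have e₃ := bits_mul_le a₀ b₁
  have e₄ := bits_mul_le a₀ b₀
  have e₅ := bits_mul_two_pow_le a₁ h
  have e₆ := bits_mul_two_pow_le b₁ h
  have e₇ := bits_mul_two_pow_le (a₁ * b₁) h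
  have e₈ : bits (a₁ * b₁ * 2 ^ h + a₁ * b₀) ≤ 3 * h + 1 := bits_add_le (by omega) (by omega)
  have e₉ : bits (a₁ * b₁ * 2 ^ h + a₁ * b₀ + a₀ * b₁) ≤ 3 * h + 2 :=
    bits_add_le e₈ (by omega)
  have e₁₀ := bits_mul_two_pow_le (a₁ * b₁ * 2 ^ h + a₁ * b₀ + a₀ * b₁) h
  refine ⟨by omega, ?_⟩
  rw [← ha₀, ← hb₀]
  ring

/-- `q` multiplies any two integers of at most `s` bits within `L s` bit operations, `s ≥ 1`. -/
def MultipliesInt (q : Prog) (L : ℕ → ℕ) : Prop :=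
  ∀ s : ℕ, 1 ≤ s → ∀ a b : ℤ, bits a ≤ s → bits b ≤ s → Computes q [a, b] [a * b] (L s)

/-- Multiplication of integers of any signs by a program `q` for nonnegative integers. -/
def signedMul (q : Prog) : Prog :=
  .seq (.sub 3 2 0) <|
  .seq (.sub 4 2 1) <|
  .ifPos 3
    (.ifPos 4 (.call [0] q [3, 4]) (.seq (.call [0] q [3, 1]) (.sub 0 2 0)))
    (.ifPos 4 (.seq (.call [0] q [0, 4]) (.sub 0 2 0)) (.call [0] q [0, 1]))

theorem multipliesInt_signedMul {q : Prog} {F : ℕ → ℕ} (hq : MultipliesNat q F) :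
    MultipliesInt (signedMul q) fun s => F s + 30 * s := by
  intro n hn a b ha hb
  have h1 := abs_lt.1 (bits_le.1 ha)
  have h2 := abs_lt.1 (bits_le.1 hb)
  have hab := bits_mul_le a b
  refine Wp.computes_of_forall fun s => ?_
  rw [frame_pad _ 3]
  simp [signedMul]
  refine Wp.ifPos (fun h3 => Wp.ifPos (fun h4 => ?_) fun h4 => ?_) fun h3 =>
    Wp.ifPos (fun h4 => ?_) fun h4 => ?_
  all_goals simp at h3 h4 ⊢
  · refine Wp.call (hq n hn (-a) (-b) (by linarith) (by linarith) (by linarith) (by linarith)) rfl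
      le_rfl fun t ht => ?_
    simp [passCost]
    omega
  · refine Wp.call (hq n hn (-a) b (by linarith) (by linarith) (by linarith) (by linarith)) rfl
      le_rfl fun t ht => ?_
    simp [passCost]
    omega
  · refine Wp.call (hq n hn a (-b) (by linarith) (by linarith) (by linarith) (by linarith)) rfl
      le_rfl fun t ht => ?_
    simp [passCost]
    omega
  · refine Wp.call (hq n hn a b (by linarith) (by linarith) (by linarith) (by linarith)) rfl
      le_rfl fun t ht => ?_
    simp [passCost]
    omega

/-- A multiplication program for integers of any signs with a convenient bound `L` for its bit
complexity: `L` is superadditive without exception and at least linear. -/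
structure FastMul (q : Prog) (L : ℕ → ℕ) : Prop where
  multiplies : MultipliesInt q L
  add_le : ∀ a b, L a + L b ≤ L (a + b)
  le_self : ∀ s, s ≤ L s

theorem FastMul.mono {q : Prog} {L : ℕ → ℕ} (h : FastMul q L) {a b : ℕ} (hab : a ≤ b) :
    L a ≤ L b := by
  obtain ⟨c, rfl⟩ := Nat.exists_eq_add_of_le hab
  have := h.add_le a c
  omega

/-- The map `n ↦ n / 2 + 1` of `multipliesNat_halvedMul` has the fixed point `2`, and its `i`-th iterate
is at most `(n - 2) / 2 ^ i + 2`. -/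
theorem multipliesNat_iterate {q : Prog} {F : ℕ → ℕ} (hq : MultipliesNat q F)
    (hF : ∀ a b, 1 ≤ a → a ≤ b → F a ≤ F b) (i : ℕ) :
    ∃ c, MultipliesNat (halvedMul^[i] q) fun n => 4 ^ i * F ((n - 2) / 2 ^ i + 2) + c * n := by
  induction i with
  | zero =>
    refine ⟨0, fun n hn a b ha ha' hb hb' => (hq n hn a b ha ha' hb hb').mono ?_⟩
    have := hF n (n - 2 + 2) hn (by omega)
    simpa using this
  | succ i ih =>
    obtain ⟨c, hc⟩ := ih
    refine ⟨4 * c + 400, fun n hn a b ha ha' hb hb' => ?_⟩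
    rw [Function.iterate_succ_apply']
    refine (multipliesNat_halvedMul hc n hn a b ha ha' hb hb').mono ?_
    have h1 : (n / 2 + 1 - 2) / 2 ^ i = (n - 2) / 2 ^ (i + 1) := by
      rw [pow_succ', ← Nat.div_div_eq_div_mul]
      congr 1
      omega
    have h2 : c * (n / 2 + 1) ≤ c * n := Nat.mul_le_mul_left c (by omega)
    simp only [h1, pow_succ 4 i]
    generalize F _ = x
    nlinarith

/-- Cutting the factors into pieces yields, for each `i`, a multiplication program that calls
the given one for numbers of at most `s / 2 ^ i` bits only (up to a constant), at the price of a
constant factor. -/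
theorem exists_fastMul {q : Prog} {F : ℕ → ℕ} (hq : MultipliesNat q F)
    (hF : ∀ a b, 1 ≤ a → 1 ≤ b → F a + F b ≤ F (a + b)) (i : ℕ) :
    ∃ q' A, FastMul q' fun s => A * ((if s / 2 ^ i = 0 then 0 else F (s / 2 ^ i)) + s) := by
  have hmono : ∀ a b, 1 ≤ a → a ≤ b → F a ≤ F b := by
    intro a b ha hab
    rcases hab.eq_or_lt with rfl | h
    · rfl
    · have := hF a (b - a) ha (by omega)
      rw [show a + (b - a) = b by omega] at this
      omega
  obtain ⟨c, hc⟩ := multipliesNat_iterate hq hmono (i + 2)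
  refine ⟨signedMul (halvedMul^[i + 2] q), 4 ^ (i + 2) * (1 + F 2) + c + 30, ?_, ?_, ?_⟩
  · intro s hs a b ha hb
    refine (multipliesInt_signedMul hc s hs a b ha hb).mono ?_
    beta_reduce
    set y := s / 2 ^ i with hy
    have h1 : (s - 2) / 2 ^ (i + 2) ≤ y / 4 := by
      rw [hy, Nat.div_div_eq_div_mul, pow_add]
      exact Nat.div_le_div_right (by omega)
    generalize (s - 2) / 2 ^ (i + 2) = x at h1
    clear_value y
    have h2 : F (x + 2) ≤ (if y = 0 then 0 else F y) + F 2 := by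
      split_ifs with h0
      · exact (hmono _ 2 (by omega) (by omega)).trans (by omega)
      · rcases le_or_gt y 2 with h | h
        · exact (hmono _ 2 (by omega) (by omega)).trans (by omega)
        · exact (hmono _ y (by omega) (by omega)).trans (by omega)
    generalize (if y = 0 then 0 else F y) = z at h2 ⊢
    have h3 : F 2 * 1 ≤ F 2 * (z + s) := Nat.mul_le_mul_left _ (by omega)
    have h4 : F (x + 2) ≤ (1 + F 2) * (z + s) := by linarith
    have h5 := Nat.mul_le_mul_left (4 ^ (i + 2)) h4
    nlinarith [Nat.zero_le (c * z)]
  · intro a b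
    rw [← mul_add]
    refine Nat.mul_le_mul_left _ ?_
    have h1 : a / 2 ^ i + b / 2 ^ i ≤ (a + b) / 2 ^ i := by
      rw [Nat.le_div_iff_mul_le (by positivity), add_mul]
      exact add_le_add (Nat.div_mul_le_self ..) (Nat.div_mul_le_self ..)
    have h2 : (if a / 2 ^ i = 0 then 0 else F (a / 2 ^ i)) +
        (if b / 2 ^ i = 0 then 0 else F (b / 2 ^ i)) ≤
        if (a + b) / 2 ^ i = 0 then 0 else F ((a + b) / 2 ^ i) := by
      generalize a / 2 ^ i = x at *
      generalize b / 2 ^ i = y at *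
      generalize (a + b) / 2 ^ i = z at *
      rcases Nat.eq_zero_or_pos x with rfl | hx <;> rcases Nat.eq_zero_or_pos y with rfl | hy
      · simp
      · simp only [if_true, zero_add]
        rw [if_neg hy.ne', if_neg (by omega)]
        exact hmono _ _ hy (by omega)
      · simp only [if_true, add_zero]
        rw [if_neg hx.ne', if_neg (by omega)]
        exact hmono _ _ hx (by omega)
      · rw [if_neg hx.ne', if_neg hy.ne', if_neg (by omega)]
        exact (hF x y hx hy).trans (hmono _ _ (by omega) h1)
    omega
  · intro s
    exact (Nat.le_add_left s _).trans (Nat.le_mul_of_pos_left _ (by positivity))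

/-! ### Binary splitting -/

/-- Multiplication of the Gaussian integers `a + b i` and `c + d i`. -/
def complexMul (q : Prog) : Prog :=
  .seq (.call [4] q [0, 2]) <|
  .seq (.call [5] q [1, 3]) <|
  .seq (.call [6] q [0, 3]) <|
  .seq (.call [7] q [1, 2]) <|
  .seq (.sub 0 4 5) <|
  .add 1 6 7

theorem FastMul.complexMul {q : Prog} {L : ℕ → ℕ} (hq : FastMul q L) {s : ℕ} (hs : 1 ≤ s)
    {a b c d : ℤ} (ha : bits a ≤ s) (hb : bits b ≤ s) (hc : bits c ≤ s) (hd : bits d ≤ s) :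
    Computes (complexMul q) [a, b, c, d] [a * c - b * d, a * d + b * c] (4 * L s + 40 * s) := by
  refine Wp.computes_of_forall fun s' => ?_
  rw [frame_pad _ 4]
  simp [BitRAM.complexMul]
  refine Wp.call (hq.multiplies s hs a c ha hc) rfl le_rfl fun t₁ ht₁ => ?_
  simp [passCost]
  refine Wp.call (hq.multiplies s hs b d hb hd) rfl le_rfl fun t₂ ht₂ => ?_
  simp [passCost]
  refine Wp.call (hq.multiplies s hs a d ha hd) rfl le_rfl fun t₃ ht₃ => ?_
  simp [passCost]
  refine Wp.call (hq.multiplies s hs b c hb hc) rfl le_rfl fun t₄ ht₄ => ?_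
  simp [passCost]
  have e₁ := bits_mul_le a c
  have e₂ := bits_mul_le b d
  have e₃ := bits_mul_le a d
  have e₄ := bits_mul_le b c
  refine ⟨by omega, fun i hi => ?_⟩
  interval_cases i <;> simp

/-- The denominator `∏ l ∈ [a, b), l * 2 ^ e` of a partial sum of the exponential series. -/
def splitQ (e a b : ℕ) : ℤ := ∏ l ∈ Finset.Ico a b, (l : ℤ) * 2 ^ e

/-- The numerator of the product `∏ l ∈ [a, b), i m / (l * 2 ^ e)` of quotients of successive terms
of the exponential series for `i m / 2 ^ e`. -/
def splitP (m : ℤ) (a b : ℕ) : GaussianInt := ⟨0, m⟩ ^ (b - a)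

/-- The numerator, over the denominator `splitQ e a b`, of the sum over `k ∈ [a, b)` of the products
`∏ l ∈ [a, k], i m / (l * 2 ^ e)`. -/
def splitT (m : ℤ) (e a b : ℕ) : GaussianInt :=
  ∑ k ∈ Finset.Ico a b, splitP m a (k + 1) * splitQ e (k + 1) b

theorem splitQ_mul (e : ℕ) {a b c : ℕ} (hab : a ≤ b) (hbc : b ≤ c) :
    splitQ e a b * splitQ e b c = splitQ e a c :=
  Finset.prod_Ico_consecutive _ hab hbc

theorem splitP_mul (m : ℤ) {a b c : ℕ} (hab : a ≤ b) (hbc : b ≤ c) :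
    splitP m a b * splitP m b c = splitP m a c := by
  rw [splitP, splitP, splitP, ← pow_add]
  congr 1
  omega

theorem splitT_split (m : ℤ) (e : ℕ) {a b c : ℕ} (hab : a ≤ b) (hbc : b ≤ c) :
    splitT m e a b * splitQ e b c + splitP m a b * splitT m e b c = splitT m e a c := by
  rw [splitT, splitT, splitT, ← Finset.sum_Ico_consecutive _ hab hbc, Finset.sum_mul,
    Finset.mul_sum]
  congr 1
  · refine Finset.sum_congr rfl fun k hk => ?_
    rw [Finset.mem_Ico] at hk
    rw [← splitQ_mul e (show k + 1 ≤ b by omega) hbc]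
    push_cast
    ring
  · refine Finset.sum_congr rfl fun k hk => ?_
    rw [Finset.mem_Ico] at hk
    rw [← splitP_mul m hab (show b ≤ k + 1 by omega)]
    ring

/-- A bound for the number of bits of the results of binary splitting on `[a, b)`. -/
def splitWeight (e a b : ℕ) : ℕ := ∑ l ∈ Finset.Ico a b, (bits (l : ℤ) + e + 1)

theorem splitWeight_add (e : ℕ) {a b c : ℕ} (hab : a ≤ b) (hbc : b ≤ c) :
    splitWeight e a b + splitWeight e b c = splitWeight e a c :=
  Finset.sum_Ico_consecutive _ hab hbc

theorem splitWeight_succ (e : ℕ) {a b : ℕ} (hab : a ≤ b) :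
    splitWeight e a (b + 1) = splitWeight e a b + (bits (b : ℤ) + e + 1) :=
  Finset.sum_Ico_succ_top hab _

theorem splitQ_nonneg (e a b : ℕ) : 0 ≤ splitQ e a b := Finset.prod_nonneg fun _ _ => by positivity

theorem splitQ_pos (e : ℕ) {a : ℕ} (ha : 1 ≤ a) (b : ℕ) : 0 < splitQ e a b :=
  Finset.prod_pos fun l hl => by
    have : 0 < l := by have := (Finset.mem_Ico.1 hl).1; omega
    positivity

theorem splitQ_lt (e : ℕ) {a b : ℕ} (hab : a < b) : splitQ e a b < 2 ^ splitWeight e a b := by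
  induction b, hab using Nat.le_induction with
  | base =>
    have := abs_lt_two_pow_bits (a : ℤ)
    rw [abs_of_nonneg (by positivity)] at this
    simp only [splitQ, splitWeight, Nat.succ_eq_add_one, Nat.Ico_succ_singleton,
      Finset.prod_singleton, Finset.sum_singleton]
    rw [pow_succ, pow_add]
    have h2 : (0 : ℤ) < 2 ^ e := by positivity
    nlinarith
  | succ b hab ih =>
    have h1 : a ≤ b := by omega
    have := abs_lt_two_pow_bits (b : ℤ)
    rw [abs_of_nonneg (by positivity)] at this
    rw [splitWeight_succ e h1, splitQ, Finset.prod_Ico_succ_top h1, ← splitQ, pow_add]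
    refine mul_lt_mul'' ih ?_ (splitQ_nonneg ..) (by positivity)
    rw [pow_succ, pow_add]
    have h2 : (0 : ℤ) < 2 ^ e := by positivity
    nlinarith

/-- The norm `|x| + |y|` of the Gaussian integer `x + y i`. -/
def taxi (z : GaussianInt) : ℤ := |z.re| + |z.im|

theorem taxi_add (z w : GaussianInt) : taxi (z + w) ≤ taxi z + taxi w := by
  have h1 := abs_add_le z.re w.re
  have h2 := abs_add_le z.im w.im
  simp only [taxi, Zsqrtd.re_add, Zsqrtd.im_add]
  linarith

theorem taxi_mul (z w : GaussianInt) : taxi (z * w) ≤ taxi z * taxi w := by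
  have h1 := abs_sub (z.re * w.re) (z.im * w.im)
  have h2 := abs_add_le (z.re * w.im) (z.im * w.re)
  simp only [abs_mul] at h1 h2
  have e : (z * w).re = z.re * w.re - z.im * w.im := by rw [Zsqrtd.re_mul]; ring
  simp only [taxi, e, Zsqrtd.im_mul]
  nlinarith

theorem taxi_nonneg (z : GaussianInt) : 0 ≤ taxi z := by unfold taxi; positivity

theorem bits_re_le {z : GaussianInt} {n : ℕ} (h : taxi z < 2 ^ n) : bits z.re ≤ n :=
  bits_le.2 (by have := abs_nonneg z.im; unfold taxi at h; linarith)

theorem bits_im_le {z : GaussianInt} {n : ℕ} (h : taxi z < 2 ^ n) : bits z.im ≤ n :=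
  bits_le.2 (by have := abs_nonneg z.re; unfold taxi at h; linarith)

theorem taxi_splitP_le {m : ℤ} {e : ℕ} (hm : bits m ≤ e) (a b : ℕ) :
    taxi (splitP m a b) ≤ 2 ^ (e * (b - a)) := by
  have h0 : taxi ⟨0, m⟩ ≤ 2 ^ e := by simpa [taxi] using (bits_le.1 hm).le
  rw [splitP, pow_mul]
  induction b - a with
  | zero => simp [taxi]
  | succ n ih =>
    rw [pow_succ, pow_succ]
    exact (taxi_mul _ _).trans (mul_le_mul ih h0 (taxi_nonneg _) (by positivity))

theorem le_splitWeight (e a b : ℕ) : (e + 1) * (b - a) ≤ splitWeight e a b := by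
  rw [mul_comm, ← smul_eq_mul, ← Nat.card_Ico]
  exact Finset.card_nsmul_le_sum _ _ _ fun l _ => by omega

theorem taxi_splitP_lt {m : ℤ} {e : ℕ} (hm : bits m ≤ e) {a b : ℕ} (hab : a < b) :
    taxi (splitP m a b) < 2 ^ splitWeight e a b := by
  refine (taxi_splitP_le hm a b).trans_lt (pow_lt_pow_right₀ (by norm_num) ?_)
  refine lt_of_lt_of_le ?_ (le_splitWeight e a b)
  rw [add_mul]
  omega

theorem splitT_succ (m : ℤ) (e : ℕ) {a b : ℕ} (hab : a ≤ b) :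
    splitT m e a (b + 1) = splitT m e a b * ((b : ℤ) * 2 ^ e : ℤ) + splitP m a (b + 1) := by
  rw [← splitT_split m e hab (Nat.le_succ b), ← splitP_mul m hab (Nat.le_succ b)]
  simp [splitQ, splitT]

theorem taxi_splitT_lt {m : ℤ} {e : ℕ} (hm : bits m ≤ e) {a b : ℕ} (hab : a ≤ b) :
    taxi (splitT m e a b) < 2 ^ splitWeight e a b := by
  induction b, hab using Nat.le_induction with
  | base => simp [splitT, splitWeight, taxi]
  | succ b hab ih =>
    have hb := abs_lt_two_pow_bits (b : ℤ)
    rw [abs_of_nonneg (by positivity)] at hb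
    have h0 : taxi (((b : ℤ) * 2 ^ e : ℤ) : GaussianInt) ≤ 2 ^ (bits (b : ℤ) + e) := by
      simp only [taxi, Zsqrtd.re_intCast, Zsqrtd.im_intCast, abs_zero, add_zero]
      rw [abs_of_nonneg (by positivity), pow_add]
      exact mul_le_mul_of_nonneg_right hb.le (by positivity)
    have h1 : taxi (splitP m a (b + 1)) ≤ 2 ^ splitWeight e a b * 2 ^ (bits (b : ℤ) + e) := by
      refine (taxi_splitP_le hm _ _).trans ?_
      rw [← pow_add]
      refine pow_le_pow_right₀ (by norm_num) ?_
      have := le_splitWeight e a b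
      rw [show b + 1 - a = (b - a) + 1 by omega, mul_add]
      rw [add_mul] at this
      omega
    have h2 : taxi (splitT m e a b * ((b : ℤ) * 2 ^ e : ℤ)) <
        2 ^ splitWeight e a b * 2 ^ (bits (b : ℤ) + e) :=
      (taxi_mul _ _).trans_lt ((mul_le_mul_of_nonneg_left h0 (taxi_nonneg _)).trans_lt
        (mul_lt_mul_of_pos_right ih (by positivity)))
    rw [splitT_succ m e hab, splitWeight_succ e hab]
    calc _ ≤ _ := taxi_add _ _
      _ < 2 ^ splitWeight e a b * 2 ^ (bits (b : ℤ) + e) +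
          2 ^ splitWeight e a b * 2 ^ (bits (b : ℤ) + e) := by linarith
      _ = _ := by rw [pow_add 2 (splitWeight e a b), pow_succ]; ring

/-- Binary splitting: from `a < b`, `m` and `e` the procedure computes the real and imaginary part
of `splitP m a b`, then `splitQ e a b`, then the real and imaginary part of `splitT m e a b`. -/
def binarySplit (q : Prog) : Prog :=
  .seq (.const 5 1) <|
  .seq (.add 6 0 5) <|
  .seq (.sub 6 1 6) <|
  .ifPos 6
    (.seq (.add 6 0 1) <|
      .seq (.shr 6 6 5) <|
      .seq (.recur [7, 8, 9, 10, 11] [0, 6, 2, 3]) <|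
      .seq (.recur [12, 13, 14, 15, 16] [6, 1, 2, 3]) <|
      .seq (.call [0, 1] (complexMul q) [7, 8, 12, 13]) <|
      .seq (.call [2] q [9, 14]) <|
      .seq (.call [3] q [10, 14]) <|
      .seq (.call [4] q [11, 14]) <|
      .seq (.call [17, 18] (complexMul q) [7, 8, 15, 16]) <|
      .seq (.add 3 3 17) <|
      .add 4 4 18)
    (.seq (.shl 5 0 3) <|
      .seq (.move 1 2) <|
      .seq (.move 4 2) <|
      .seq (.move 2 5) <|
      .seq (.const 0 0) <|
      .const 3 0)

theorem computes_binarySplit_leaf (q : Prog) {m : ℤ} {e : ℕ} (hm : bits m ≤ e) (a : ℕ) :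
    Computes (binarySplit q) [(a : ℤ), ((a + 1 : ℕ) : ℤ), m, (e : ℤ)]
      [(splitP m a (a + 1)).re, (splitP m a (a + 1)).im, splitQ e a (a + 1),
        (splitT m e a (a + 1)).re, (splitT m e a (a + 1)).im] (50 * splitWeight e a (a + 1)) := by
  have hP : splitP m a (a + 1) = ⟨0, m⟩ := by simp [splitP]
  have hQ : splitQ e a (a + 1) = a * 2 ^ e := by simp [splitQ]
  have hT : splitT m e a (a + 1) = ⟨0, m⟩ := by simp [splitT, splitQ, hP]
  have hw : splitWeight e a (a + 1) = bits (a : ℤ) + e + 1 := by simp [splitWeight]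
  have h1 := bits_natCast_le e
  have h2 := bits_mul_two_pow_le (a : ℤ) e
  have h3 : bits ((a : ℤ) + 1) ≤ bits (a : ℤ) + 1 + 1 :=
    bits_add_le (n := bits (a : ℤ) + 1) (by omega) (by rw [bits_one]; omega)
  rw [hP, hQ, hT, hw]
  refine Wp.computes_of_forall fun s => ?_
  rw [frame_pad _ 3]
  simp [BitRAM.binarySplit]
  refine Wp.ifPos (fun h => ?_) fun h => ?_
  · simp at h
  simp
  refine ⟨by omega, fun i hi => ?_⟩
  interval_cases i <;> simp

theorem computes_binarySplit_node {q : Prog} {L : ℕ → ℕ} (hq : FastMul q L) {m : ℤ} {e : ℕ}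
    (hm : bits m ≤ e) {a b c T₁ T₂ : ℕ} (hac : a < c) (hcb : c < b) (hc : (a + b) / 2 = c)
    (h₁ : Computes (binarySplit q) [(a : ℤ), (c : ℤ), m, (e : ℤ)]
        [(splitP m a c).re, (splitP m a c).im, splitQ e a c, (splitT m e a c).re,
          (splitT m e a c).im] T₁)
    (h₂ : Computes (binarySplit q) [(c : ℤ), (b : ℤ), m, (e : ℤ)]
        [(splitP m c b).re, (splitP m c b).im, splitQ e c b, (splitT m e c b).re,
          (splitT m e c b).im] T₂) :
    Computes (binarySplit q) [(a : ℤ), (b : ℤ), m, (e : ℤ)]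
        [(splitP m a b).re, (splitP m a b).im, splitQ e a b, (splitT m e a b).re,
          (splitT m e a b).im] (T₁ + T₂ + 300 * L (splitWeight e a b)) := by
  have hP := splitP_mul m hac.le hcb.le
  have hQ := splitQ_mul e hac.le hcb.le
  have hT := splitT_split m e hac.le hcb.le
  have hw := splitWeight_add e hac.le hcb.le
  have hwa : 1 ≤ splitWeight e a c :=
    (Nat.mul_pos (Nat.succ_pos e) (Nat.sub_pos_of_lt hac)).trans_le (le_splitWeight e a c)
  have hwb := splitWeight_succ e (show c ≤ b - 1 by omega)
  rw [show b - 1 + 1 = b by omega] at hwb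
  have hLw := hq.le_self (splitWeight e a b)
  set w := splitWeight e a b
  have hw1 : 1 ≤ w := by omega
  have hwac : splitWeight e a c ≤ w := by omega
  have hwcb : splitWeight e c b ≤ w := by omega
  have pw : ∀ {k : ℕ}, k ≤ w → (2 : ℤ) ^ k ≤ 2 ^ w := fun h => pow_le_pow_right₀ (by norm_num) h
  have hP₁ := (taxi_splitP_lt hm hac).trans_le (pw hwac)
  have hP₂ := (taxi_splitP_lt hm hcb).trans_le (pw hwcb)
  have hP₃ : taxi (splitP m a b) < 2 ^ w := taxi_splitP_lt hm (hac.trans hcb)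
  have hT₁ := (taxi_splitT_lt hm hac.le).trans_le (pw hwac)
  have hT₂ := (taxi_splitT_lt hm hcb.le).trans_le (pw hwcb)
  have hT₃ : taxi (splitT m e a b) < 2 ^ w := taxi_splitT_lt hm (hac.trans hcb).le
  have bQ : ∀ {x y : ℕ}, splitQ e x y < 2 ^ w → bits (splitQ e x y) ≤ w := fun h =>
    bits_le.2 (by rwa [abs_of_nonneg (splitQ_nonneg ..)])
  have hQ₁ := bQ ((splitQ_lt e hac).trans_le (pw hwac))
  have hQ₂ := bQ ((splitQ_lt e hcb).trans_le (pw hwcb))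
  have hQ₃ := bQ (splitQ_lt e (hac.trans hcb))
  clear_value w
  have hb : bits (b : ℤ) ≤ w := by
    have h1 : bits (((b - 1 : ℕ) : ℤ) + 1) ≤ bits ((b - 1 : ℕ) : ℤ) + 1 + 1 :=
      bits_add_le (n := bits ((b - 1 : ℕ) : ℤ) + 1) (by omega) (by rw [bits_one]; omega)
    rw [show ((b - 1 : ℕ) : ℤ) + 1 = b by omega] at h1
    omega
  have ha : bits (a : ℤ) ≤ w := (bits_natCast_mono (by omega)).trans hb
  have hc' : bits (c : ℤ) ≤ w := (bits_natCast_mono (by omega)).trans hb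
  have he : bits (e : ℤ) ≤ w := (bits_natCast_le e).trans (by omega)
  have hmw : bits m ≤ w := by omega
  have ha1 : bits ((a : ℤ) + 1) ≤ w := (bits_nonneg_mono (by positivity) (by omega)).trans hb
  have hba : bits ((b : ℤ) - (a + 1)) ≤ w := (bits_nonneg_mono (by omega) (by omega)).trans hb
  have hab : bits ((a : ℤ) + b) ≤ w + 1 := bits_add_le ha hb
  have hcz : ((a : ℤ) + b) / 2 = (c : ℤ) := by omega
  generalize splitP m a b = P at *
  generalize splitP m a c = P₁ at *
  generalize splitP m c b = P₂ at *
  generalize splitT m e a b = T at *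
  generalize splitT m e a c = U₁ at *
  generalize splitT m e c b = U₂ at *
  generalize splitQ e a b = Q at *
  generalize splitQ e a c = Q₁ at *
  generalize splitQ e c b = Q₂ at *
  have hU : taxi (P₁ * U₂) < 2 ^ (w + w) := by
    rw [pow_add]
    exact (taxi_mul _ _).trans_lt (mul_lt_mul'' hP₁ hT₂ (taxi_nonneg _) (taxi_nonneg _))
  have cP : Computes (complexMul q) [P₁.re, P₁.im, P₂.re, P₂.im] [P.re, P.im]
      (4 * L w + 40 * w) := by
    have := hq.complexMul hw1 (bits_re_le hP₁) (bits_im_le hP₁) (bits_re_le hP₂) (bits_im_le hP₂)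
    rw [← hP, Zsqrtd.re_mul, Zsqrtd.im_mul]
    simpa [← sub_eq_add_neg] using this
  obtain ⟨U, hUe⟩ : ∃ U, P₁ * U₂ = U := ⟨_, rfl⟩
  have cU : Computes (complexMul q) [P₁.re, P₁.im, U₂.re, U₂.im] [U.re, U.im]
      (4 * L w + 40 * w) := by
    have := hq.complexMul hw1 (bits_re_le hP₁) (bits_im_le hP₁) (bits_re_le hT₂) (bits_im_le hT₂)
    rw [← hUe, Zsqrtd.re_mul, Zsqrtd.im_mul]
    simpa [← sub_eq_add_neg] using this
  have cQ := hq.multiplies w hw1 Q₁ Q₂ hQ₁ hQ₂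
  have cR := hq.multiplies w hw1 U₁.re Q₂ (bits_re_le hT₁) hQ₂
  have cI := hq.multiplies w hw1 U₁.im Q₂ (bits_im_le hT₁) hQ₂
  have hTr : U₁.re * Q₂ + U.re = T.re := by
    rw [← hT, ← hUe]; simp
  have hTi : U₁.im * Q₂ + U.im = T.im := by
    rw [← hT, ← hUe]; simp
  rw [hUe] at hU
  rw [hQ] at cQ
  have e₁ := bits_mul_le U₁.re Q₂
  have e₂ := bits_mul_le U₁.im Q₂
  have f₁ := bits_re_le hP₁
  have f₂ := bits_im_le hP₁
  have f₃ := bits_re_le hP₂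
  have f₄ := bits_im_le hP₂
  have f₅ := bits_re_le hT₁
  have f₆ := bits_im_le hT₁
  have f₇ := bits_re_le hT₂
  have f₈ := bits_im_le hT₂
  have f₉ := bits_re_le hP₃
  have f₁₀ := bits_im_le hP₃
  have f₁₁ := bits_re_le hU
  have f₁₂ := bits_im_le hU
  suffices key : ∀ s,
      Computes s [(a : ℤ), (c : ℤ), m, (e : ℤ)] [P₁.re, P₁.im, Q₁, U₁.re, U₁.im] T₁ →
      Computes s [(c : ℤ), (b : ℤ), m, (e : ℤ)] [P₂.re, P₂.im, Q₂, U₂.re, U₂.im] T₂ →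
      Wp s (binarySplit q) (frame [(a : ℤ), (b : ℤ), m, (e : ℤ)]) 0 fun τ t =>
        t ≤ T₁ + T₂ + 300 * L w ∧ ∀ i < [P.re, P.im, Q, T.re, T.im].length,
          τ i = frame [P.re, P.im, Q, T.re, T.im] i from (key _ h₁ h₂).computes
  intro s h₁ h₂
  rw [frame_pad _ 15]
  simp [BitRAM.binarySplit]
  refine Wp.ifPos (fun _ => ?_) fun h => ?_
  swap
  · simp at h; omega
  simp [hcz]
  refine Wp.recur h₁ rfl le_rfl fun t₁ ht₁ => ?_
  simp [passCost, List.range, List.range.loop]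
  refine Wp.recur h₂ rfl le_rfl fun t₂ ht₂ => ?_
  simp [passCost, List.range, List.range.loop]
  refine Wp.call cP rfl le_rfl fun t₃ ht₃ => ?_
  simp [passCost, List.range, List.range.loop]
  refine Wp.call cQ rfl le_rfl fun t₄ ht₄ => ?_
  simp [passCost, List.range, List.range.loop]
  refine Wp.call cR rfl le_rfl fun t₅ ht₅ => ?_
  simp [passCost, List.range, List.range.loop]
  refine Wp.call cI rfl le_rfl fun t₆ ht₆ => ?_
  simp [passCost, List.range, List.range.loop]
  refine Wp.call cU rfl le_rfl fun t₇ ht₇ => ?_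
  simp [passCost, List.range, List.range.loop, hTr, hTi]
  constructor
  · omega
  · intro i hi
    interval_cases i <;> simp

theorem FastMul.binarySplit {q : Prog} {L : ℕ → ℕ} (hq : FastMul q L) {m : ℤ} {e : ℕ}
    (hm : bits m ≤ e) (d : ℕ) : ∀ a b : ℕ, a < b → b - a ≤ 2 ^ d →
      Computes (binarySplit q) [(a : ℤ), (b : ℤ), m, (e : ℤ)]
        [(splitP m a b).re, (splitP m a b).im, splitQ e a b, (splitT m e a b).re,
          (splitT m e a b).im] (300 * (d + 1) * L (splitWeight e a b)) := by
  have leaf : ∀ (a d : ℕ), 50 * splitWeight e a (a + 1) ≤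
      300 * (d + 1) * L (splitWeight e a (a + 1)) := fun a d => by
    have := hq.le_self (splitWeight e a (a + 1))
    nlinarith [Nat.zero_le (d * L (splitWeight e a (a + 1)))]
  induction d with
  | zero =>
    intro a b hab hd
    obtain rfl : b = a + 1 := by omega
    exact (computes_binarySplit_leaf q hm a).mono (leaf a 0)
  | succ d ih =>
    intro a b hab hd
    rcases eq_or_ne b (a + 1) with rfl | hne
    · exact (computes_binarySplit_leaf q hm a).mono (leaf a _)
    · rw [pow_succ] at hd
      refine (computes_binarySplit_node hq hm (c := (a + b) / 2) (by omega) (by omega) rfl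
        (ih _ _ (by omega) (by omega)) (ih _ _ (by omega) (by omega))).mono ?_
      have h := hq.add_le (splitWeight e a ((a + b) / 2)) (splitWeight e ((a + b) / 2) b)
      rw [splitWeight_add e (by omega) (by omega)] at h
      nlinarith [Nat.mul_le_mul_left (300 * (d + 1)) h]

/-! ### Number of terms of the exponential series -/

/-- A lower bound for the binary logarithm of `n! * 2 ^ (h * n)`. -/
def expWeight (h n : ℕ) : ℕ := ∑ k ∈ Finset.range n, (bits ((k + 1 : ℕ) : ℤ) - 1 + h)

theorem one_le_bits {k : ℕ} (hk : 1 ≤ k) : 1 ≤ bits (k : ℤ) := by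
  simpa using bits_natCast_mono hk

theorem two_le_bits {k : ℕ} (hk : 2 ≤ k) : 2 ≤ bits (k : ℤ) :=
  le_trans (by decide) (bits_natCast_mono hk)

theorem two_pow_bits_le {k : ℕ} (hk : 1 ≤ k) : 2 ^ (bits (k : ℤ) - 1) ≤ k := by
  have h : bits (k : ℤ) - 1 < (k : ℕ).size := by
    have := one_le_bits hk
    simp only [bits, Int.natAbs_natCast] at *
    omega
  exact Nat.lt_size.1 h

theorem expWeight_succ (h n : ℕ) :
    expWeight h (n + 1) = expWeight h n + (bits ((n + 1 : ℕ) : ℤ) - 1 + h) :=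
  Finset.sum_range_succ _ _

theorem two_pow_expWeight_le (h n : ℕ) : 2 ^ expWeight h n ≤ n.factorial * 2 ^ (h * n) := by
  induction n with
  | zero => simp [expWeight]
  | succ n ih =>
    have h1 := two_pow_bits_le (Nat.succ_pos n)
    rw [expWeight_succ, pow_add, pow_add, Nat.factorial_succ, mul_add, mul_one, pow_add]
    calc _ ≤ n.factorial * 2 ^ (h * n) * ((n + 1) * 2 ^ h) := by gcongr
      _ = _ := by ring

theorem le_expWeight (h n : ℕ) : n ≤ expWeight h n + 1 := by
  induction n with
  | zero => simp
  | succ n ih =>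
    rcases Nat.eq_zero_or_pos n with rfl | hn
    · omega
    · have := two_le_bits (show 2 ≤ n + 1 by omega)
      rw [expWeight_succ]
      omega

/-- From `W` and `h`, compute `n + 1` for the least `n` with `W ≤ expWeight h n`. -/
def termCount : Prog :=
  .seq (.const 2 1) <|
  .seq (.const 4 1) <|
  .seq (.move 3 0) <|
  .seq
    (.loop 3 <|
      .seq (.len 5 2) <|
      .seq (.sub 5 5 4) <|
      .seq (.add 5 5 1) <|
      .seq (.sub 3 3 5) <|
      .add 2 2 4) <|
  .move 0 2

/-- The number of terms is at most `W + 1`; minimality, `expWeight h (n - 1) < W`, is what keeps the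
numbers in the binary splitting short. -/
theorem exists_termCount (W h : ℕ) (hW : 1 ≤ W) :
    ∃ n, 1 ≤ n ∧ n ≤ W + 1 ∧ W ≤ expWeight h n ∧ expWeight h (n - 1) < W ∧
      Computes termCount [(W : ℤ), (h : ℤ)] [((n + 1 : ℕ) : ℤ)]
        (60 * (W + 2) * bits ((W + h + 2 : ℕ) : ℤ)) := by
  have hex : ∃ n, W ≤ expWeight h n := ⟨W + 1, by have := le_expWeight h (W + 1); omega⟩
  classical
  obtain ⟨n, hn, hmin⟩ : ∃ n, W ≤ expWeight h n ∧ ∀ i < n, expWeight h i < W :=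
    ⟨Nat.find hex, Nat.find_spec hex, fun i hi => not_le.1 (Nat.find_min hex hi)⟩
  have hn1 : 1 ≤ n := by
    by_contra h0
    obtain rfl : n = 0 := by omega
    simp [expWeight] at hn
    omega
  have hlast := hmin (n - 1) (by omega)
  have hnW : n ≤ W + 1 := by
    have := le_expWeight h (n - 1)
    omega
  refine ⟨n, hn1, hnW, hn, hlast, ?_⟩
  obtain ⟨B, hB⟩ : ∃ B, bits ((W + h + 2 : ℕ) : ℤ) = B := ⟨_, rfl⟩
  have hB2 : 2 ≤ B := hB ▸ two_le_bits (by omega)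
  have small : ∀ z : ℤ, |z| ≤ W + h + 2 → bits z ≤ B := fun z hz => by
    rw [← hB]
    refine bits_mono (hz.trans_eq ?_)
    rw [abs_of_nonneg (by positivity)]
    push_cast
    ring
  rw [hB]
  refine Wp.computes_of_forall fun s => ?_
  rw [frame_pad _ 4]
  simp [termCount]
  refine Wp.loop (fun j τ t => ∃ i x, i + j = n ∧
    τ = frame [(W : ℤ), h, (i : ℤ) + 1, (W : ℤ) - expWeight h i, 1, x] ∧
    t ≤ 10 + B + i * (20 * B)) ?_ ?_ n _ _ ⟨0, 0, by simp, by simp [expWeight], ?_⟩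
  · rintro j τ t ⟨i, x, hij, rfl, ht⟩
    have hi := hmin i (by omega)
    simp
    refine ⟨hi, i + 1, by omega, ⟨bits ((i : ℤ) + 1) - 1 + h, ?_⟩, ?_⟩
    · have := one_le_bits (Nat.succ_pos i)
      push_cast at this
      rw [expWeight_succ]
      push_cast [Nat.cast_sub this]
      congr 5
      ring
    · have h1 : bits ((i : ℤ) + 1) ≤ i + 1 := by simpa using bits_natCast_le (i + 1)
      have h2 := one_le_bits (Nat.succ_pos i)
      push_cast at h2
      have b1 := small ((W : ℤ) - expWeight h i) (by rw [abs_le]; constructor <;> omega)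
      have b2 := small ((i : ℤ) + 1) (by rw [abs_le]; constructor <;> omega)
      have b3 := small (bits ((i : ℤ) + 1) : ℤ) (by rw [abs_le]; constructor <;> omega)
      have b4 := small ((bits ((i : ℤ) + 1) : ℤ) - 1) (by rw [abs_le]; constructor <;> omega)
      have b5 := small (h : ℤ) (by rw [abs_le]; constructor <;> omega)
      have b6 := small ((bits ((i : ℤ) + 1) : ℤ) - 1 + h) (by rw [abs_le]; constructor <;> omega)
      rw [add_mul]
      omega
  · rintro τ t ⟨i, x, hij, rfl, ht⟩
    obtain rfl : i = n := by omega
    have b1 := small ((W : ℤ) - expWeight h i) (by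
      have h1 : i - 1 + 1 = i := by omega
      have h2 := expWeight_succ h (i - 1)
      have h3 := bits_natCast_le i
      rw [h1] at h2
      rw [abs_le]; constructor <;> omega)
    have b2 := small ((i : ℤ) + 1) (by rw [abs_le]; constructor <;> omega)
    simp
    refine ⟨hn, ?_⟩
    have : i * (20 * B) ≤ (W + 1) * (20 * B) := Nat.mul_le_mul_right _ hnW
    nlinarith
  · have b1 := small (W : ℤ) (by rw [abs_le]; constructor <;> omega)
    omega

/-! ### Division -/

/-- Floor division of an integer by a power of two, with the rounding error made explicit. -/
theorem exists_ediv_two_pow (z : ℤ) (k : ℕ) :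
    ∃ θ : ℝ, 0 ≤ θ ∧ θ ≤ 1 ∧ ((z / 2 ^ k : ℤ) : ℝ) = z / 2 ^ k - θ := by
  have hk : (0 : ℤ) < 2 ^ k := by positivity
  have h1 : ((z / 2 ^ k : ℤ) : ℝ) * 2 ^ k ≤ z := by exact_mod_cast Int.ediv_mul_le z hk.ne'
  have h2 : (z : ℝ) < (((z / 2 ^ k : ℤ) : ℝ) + 1) * 2 ^ k := by
    exact_mod_cast Int.lt_ediv_add_one_mul_self z hk
  have hk' : (0 : ℝ) < 2 ^ k := by positivity
  refine ⟨z / 2 ^ k - ((z / 2 ^ k : ℤ) : ℝ), ?_, ?_, by ring⟩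
  · rw [sub_nonneg, le_div_iff₀ hk']; exact h1
  · rw [sub_le_iff_le_add, div_le_iff₀ hk']; linarith

/-- The Newton step `y ↦ y * (2 - d * y)` for the reciprocal of `d = Q / 2 ^ q`, with `W`
fractional bits. -/
def newtonStep (Q : ℤ) (q W : ℕ) (Y : ℤ) : ℤ := Y * (2 ^ W * 2 - Q * Y / 2 ^ q) / 2 ^ W

/-- The defect `1 - d * y` of the approximation `y = Y / 2 ^ W` to the reciprocal of
`d = Q / 2 ^ q`. -/
noncomputable def defect (Q : ℤ) (q W : ℕ) (Y : ℤ) : ℝ := 1 - (Q : ℝ) / 2 ^ q * (Y / 2 ^ W)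

/-- A Newton step squares the defect, up to rounding. -/
theorem defect_newtonStep {Q : ℤ} {q W : ℕ} (hQ₀ : 0 ≤ (Q : ℝ) / 2 ^ q)
    (hQ₁ : (Q : ℝ) / 2 ^ q ≤ 1) {Y : ℤ} (hY : |defect Q q W Y| ≤ 1 / 2) :
    |defect Q q W (newtonStep Q q W Y) - defect Q q W Y ^ 2| ≤ 3 / 2 * (1 / 2 ^ W) := by
  obtain ⟨θ₁, h₁, h₂, h₃⟩ := exists_ediv_two_pow (Q * Y) q
  obtain ⟨θ₂, h₄, h₅, h₆⟩ := exists_ediv_two_pow (Y * (2 ^ W * 2 - Q * Y / 2 ^ q)) W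
  have hW : (0 : ℝ) < 2 ^ W := by positivity
  have hq : (0 : ℝ) < 2 ^ q := by positivity
  have e : defect Q q W (newtonStep Q q W Y) - defect Q q W Y ^ 2 =
      ((Q : ℝ) / 2 ^ q * θ₂ - (1 - defect Q q W Y) * θ₁) * (1 / 2 ^ W) := by
    unfold defect newtonStep
    rw [h₆]
    push_cast
    rw [h₃]
    push_cast
    field_simp
    ring
  rw [e, abs_mul, abs_of_pos (by positivity : (0 : ℝ) < 1 / 2 ^ W)]
  refine mul_le_mul_of_nonneg_right ?_ (by positivity)
  rw [abs_le] at *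
  constructor <;> nlinarith

theorem defect_iterate {Q : ℤ} {q W : ℕ} (hQ₀ : 1 / 2 ≤ (Q : ℝ) / 2 ^ q)
    (hQ₁ : (Q : ℝ) / 2 ^ q ≤ 1) (hW : 5 ≤ W) (i : ℕ) :
    |defect Q q W ((newtonStep Q q W)^[i] (2 ^ W))| ≤ 1 / 2 ∧
      (1 ≤ i → |defect Q q W ((newtonStep Q q W)^[i] (2 ^ W))| ≤
        (1 / 2) ^ 2 ^ i + 4 * (1 / 2 ^ W)) := by
  have hε : (1 : ℝ) / 2 ^ W ≤ 1 / 32 := by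
    rw [show (32 : ℝ) = 2 ^ 5 by norm_num]
    exact one_div_pow_le_one_div_pow_of_le (by norm_num) hW
  have hε0 : (0 : ℝ) < 1 / 2 ^ W := by positivity
  induction i with
  | zero =>
    refine ⟨?_, fun h => by omega⟩
    have : defect Q q W ((newtonStep Q q W)^[0] (2 ^ W)) = 1 - (Q : ℝ) / 2 ^ q := by
      have : (0 : ℝ) < 2 ^ W := by positivity
      simp [defect]
    rw [this, abs_le]
    constructor <;> linarith
  | succ i ih =>
    have key := defect_newtonStep (W := W) (by linarith) hQ₁ ih.1
    rw [Function.iterate_succ_apply']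
    obtain ⟨ih₁, ih₂⟩ := ih
    generalize defect Q q W ((newtonStep Q q W)^[i] (2 ^ W)) = x at *
    generalize defect Q q W (newtonStep Q q W ((newtonStep Q q W)^[i] (2 ^ W))) = y at *
    generalize (1 : ℝ) / 2 ^ W = ε at *
    have hy : |y| ≤ |x| ^ 2 + 3 / 2 * ε := by
      rw [sq_abs]
      calc |y| = |y - x ^ 2 + x ^ 2| := by ring_nf
        _ ≤ |y - x ^ 2| + |x ^ 2| := abs_add_le _ _
        _ ≤ _ := by rw [abs_of_nonneg (sq_nonneg x)]; linarith
    have hx := abs_nonneg x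
    have main : |y| ≤ (1 / 2 : ℝ) ^ 2 ^ (i + 1) + 4 * ε := by
      rcases Nat.eq_zero_or_pos i with rfl | hi
      · norm_num
        nlinarith
      · have h1 := ih₂ hi
        rw [pow_succ, pow_mul]
        have h2 : (1 / 2 : ℝ) ^ 2 ^ i ≤ 1 / 4 := by
          rw [show (1 / 4 : ℝ) = (1 / 2) ^ 2 by norm_num]
          refine pow_le_pow_of_le_one (by norm_num) (by norm_num) ?_
          calc 2 = 2 ^ 1 := rfl
            _ ≤ 2 ^ i := Nat.pow_le_pow_right (by norm_num) hi
        have h3 : (0 : ℝ) < (1 / 2 : ℝ) ^ 2 ^ i := by positivity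
        generalize (1 / 2 : ℝ) ^ 2 ^ i = a at *
        have h4 : |x| ^ 2 ≤ (a + 4 * ε) ^ 2 := pow_le_pow_left₀ hx h1 2
        nlinarith
    exact ⟨by nlinarith, fun _ => main⟩

/-- From `Q > 0` and `W`, compute the reciprocal of `Q / 2 ^ bits Q` with `W` fractional bits by
Newton's method. Every step is carried out at full precision, `bits W` steps suffice. -/
def reciprocal (mul : Prog) : Prog :=
  .seq (.const 6 1) <|
  .seq (.len 2 0) <|
  .seq (.shl 3 6 1) <|
  .seq (.shl 4 3 6) <|
  .seq (.len 5 1) <|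
  .seq
    (.loop 5 <|
      .seq (.call [7] mul [0, 3]) <|
      .seq (.shr 7 7 2) <|
      .seq (.sub 7 4 7) <|
      .seq (.call [3] mul [3, 7]) <|
      .seq (.shr 3 3 1) <|
      .sub 5 5 6) <|
  .move 0 3

theorem div_two_pow_bits {Q : ℤ} (hQ : 0 < Q) :
    (1 : ℝ) / 2 ≤ (Q : ℝ) / 2 ^ bits Q ∧ (Q : ℝ) / 2 ^ bits Q ≤ 1 := by
  lift Q to ℕ using hQ.le
  have hQ : 1 ≤ Q := by exact_mod_cast hQ
  have h1 := two_pow_bits_le hQ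
  have h2 := abs_lt_two_pow_bits (Q : ℤ)
  have h3 := one_le_bits hQ
  rw [abs_of_nonneg (by positivity)] at h2
  obtain ⟨k, hk⟩ := Nat.exists_eq_add_of_le' h3
  rw [hk] at h1 h2 ⊢
  rw [Nat.add_sub_cancel] at h1
  have h1' : (2 : ℝ) ^ k ≤ Q := by exact_mod_cast h1
  have h2' : (Q : ℝ) < 2 ^ (k + 1) := by exact_mod_cast h2
  constructor
  · rw [le_div_iff₀ (by positivity), pow_succ]; push_cast; linarith
  · rw [div_le_one (by positivity)]; push_cast; linarith

theorem bits_le_of_defect {Q : ℤ} {q W : ℕ} (hQ : 1 / 2 ≤ (Q : ℝ) / 2 ^ q) {Y : ℤ}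
    (hY : |defect Q q W Y| ≤ 1 / 2) : bits Y ≤ W + 2 := by
  have hW : (0 : ℝ) < 2 ^ W := by positivity
  have h : |(Y : ℝ)| < 2 ^ (W + 2) := by
    have : |(Y : ℝ) / 2 ^ W| ≤ 3 := by
      rw [abs_le] at *
      unfold defect at hY
      constructor <;> nlinarith
    rw [abs_div, abs_of_pos hW, div_le_iff₀ hW] at this
    rw [pow_add]
    linarith
  rw [bits_le]
  exact_mod_cast h

theorem bits_pow_two_le (k : ℕ) : bits (2 ^ k) ≤ k + 1 := by
  have := bits_mul_two_pow_le 1 k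
  rw [bits_one, one_mul] at this
  omega

theorem exists_reciprocal {mul : Prog} {L : ℕ → ℕ} (hmul : FastMul mul L) {Q : ℤ} {W S : ℕ}
    (hQ : 0 < Q) (hW : 5 ≤ W) (hQS : bits Q ≤ S) (hWS : W + 3 ≤ S) :
    ∃ Y : ℤ, Computes (reciprocal mul) [Q, (W : ℤ)] [Y] (bits (W : ℤ) * (60 * L S) + 20 * S) ∧
      bits Y ≤ W + 2 ∧ |defect Q (bits Q) W Y| ≤ 5 * (1 / 2 ^ W) := by
  obtain ⟨hd₀, hd₁⟩ := div_two_pow_bits hQ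
  have hit := defect_iterate hd₀ hd₁ hW
  have hQq := abs_lt_two_pow_bits Q
  have hq1 : bits ((bits Q : ℕ) : ℤ) ≤ S := (bits_natCast_le _).trans hQS
  obtain ⟨q, hq⟩ : ∃ q, bits Q = q := ⟨_, rfl⟩
  obtain ⟨N, hN⟩ : ∃ N, bits (W : ℤ) = N := ⟨_, rfl⟩
  have hN1 : 1 ≤ N := hN ▸ one_le_bits (by omega)
  have hNW : N ≤ W := hN ▸ bits_natCast_le W
  have hLS := hmul.le_self S
  rw [hq] at hd₀ hit hQq hq1 ⊢
  have hYb := fun i => bits_le_of_defect hd₀ (hit i).1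
  obtain ⟨Y, hY⟩ : ∃ Y : ℕ → ℤ, ∀ i, (newtonStep Q q W)^[i] (2 ^ W) = Y i := ⟨_, fun _ => rfl⟩
  have hY0 : Y 0 = 2 ^ W := (hY 0).symm
  have hYs : ∀ i, Y (i + 1) = Y i * (2 ^ W * 2 - Q * Y i / 2 ^ q) / 2 ^ W := fun i => by
    rw [← hY, ← hY, Function.iterate_succ_apply', newtonStep]
  simp only [hY] at hit hYb
  have hlast : |defect Q q W (Y N)| ≤ 5 * (1 / 2 ^ W) := by
    refine ((hit N).2 hN1).trans ?_
    have h1 : W ≤ 2 ^ N := by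
      have := abs_lt_two_pow_bits (W : ℤ)
      rw [abs_of_nonneg (by positivity), hN] at this
      exact_mod_cast this.le
    have h2 : (1 / 2 : ℝ) ^ 2 ^ N ≤ (1 / 2) ^ W :=
      pow_le_pow_of_le_one (by norm_num) (by norm_num) h1
    rw [one_div_pow 2 W] at h2
    linarith
  refine ⟨Y N, ?_, hYb N, hlast⟩
  rw [hN]
  have p0 := bits_pow_two_le W
  have p1 : bits (2 ^ W * 2 : ℤ) ≤ W + 2 := by simpa [pow_succ] using bits_pow_two_le (W + 1)
  refine Wp.computes_of_forall fun s => ?_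
  rw [frame_pad _ 6]
  simp [reciprocal, hq, hN]
  refine Wp.loop (fun j τ t => ∃ i x, i + j = N ∧
    τ = frame [Q, W, q, Y i, 2 ^ W * 2, (j : ℤ), 1, x] ∧
    t ≤ 10 * S + i * (60 * L S)) ?_ ?_ N _ _ ⟨0, 0, by simp, by simp [hY0], ?_⟩
  · rintro j τ t ⟨i, x, hij, rfl, ht⟩
    have hYi := hYb i
    have a1 : bits (Q * Y i / 2 ^ q) ≤ W + 2 := by
      refine (bits_mono (abs_ediv_two_pow_le (B := |Y i|) ?_)).trans (by simpa [bits] using hYi)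
      rw [abs_mul, mul_comm]
      exact mul_le_mul_of_nonneg_left hQq.le (abs_nonneg _)
    have a2 : bits (2 ^ W * 2 - Q * Y i / 2 ^ q) ≤ W + 3 := bits_sub_le p1 a1
    have a3 := bits_mul_le Q (Y i)
    have a4 := bits_mul_le (Y i) (2 ^ W * 2 - Q * Y i / 2 ^ q)
    have a5 : bits ((j : ℤ) + 1) ≤ N := by
      simpa using (bits_natCast_le (j + 1)).trans (by omega)
    have a6 : bits (W : ℤ) ≤ W := bits_natCast_le W
    simp
    refine Wp.call (hmul.multiplies S (by omega) Q (Y i) hQS (by omega)) rfl le_rfl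
      fun t₁ ht₁ => ?_
    simp [passCost]
    refine Wp.call (hmul.multiplies S (by omega) (Y i) (2 ^ W * 2 - Q * Y i / 2 ^ q) (by omega)
      (by omega)) rfl le_rfl fun t₂ ht₂ => ?_
    simp [passCost]
    refine ⟨i + 1, by omega, ⟨_, by rw [hYs]⟩, ?_⟩
    rw [add_mul]
    omega
  · rintro τ t ⟨i, x, hij, rfl, ht⟩
    obtain rfl : i = N := by omega
    have hYi := hYb i
    simp
    nlinarith
  · have a6 : bits (W : ℤ) ≤ W := bits_natCast_le W
    omega

/-! ### The exponential function at short arguments -/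

theorem splitQ_one (e k : ℕ) : splitQ e 1 (k + 1) = k.factorial * 2 ^ (e * k) := by
  induction k with
  | zero => simp [splitQ]
  | succ k ih =>
    rw [← splitQ_mul e (Nat.le_add_left 1 k) (Nat.le_succ (k + 1)), ih, Nat.factorial_succ, mul_add,
      pow_add]
    simp [splitQ]
    ring

/-- Binary splitting on `[1, n]` evaluates a partial sum of the exponential series. -/
theorem splitT_div_splitQ (m : ℤ) (e n : ℕ) :
    (splitT m e 1 (n + 1) : ℂ) / splitQ e 1 (n + 1) =
      ∑ k ∈ Finset.range (n + 1),
        (Complex.I * ((m : ℝ) / 2 ^ e : ℝ)) ^ k / (k.factorial : ℂ) - 1 := by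
  rw [Finset.sum_range_succ']
  simp only [pow_zero, Nat.factorial_zero, Nat.cast_one, div_one, add_sub_cancel_right]
  rw [Finset.range_eq_Ico, Finset.sum_Ico_add' (fun k : ℕ =>
    (Complex.I * ((m : ℝ) / 2 ^ e : ℝ)) ^ k / (k.factorial : ℂ)), splitT, map_sum, Finset.sum_div]
  refine Finset.sum_congr (by simp) fun k hk => ?_
  rw [Finset.mem_Ico] at hk
  rw [← splitQ_mul e (show 1 ≤ k + 1 by omega) (show k + 1 ≤ n + 1 by omega), splitQ_one]
  have h1 : (splitQ e (k + 1) (n + 1) : ℂ) ≠ 0 := by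
    exact_mod_cast (splitQ_pos e (Nat.le_add_left 1 k) (n + 1)).ne'
  have h2 : (k.factorial : ℂ) ≠ 0 := by exact_mod_cast k.factorial_ne_zero
  have h3 : GaussianInt.toComplex ⟨0, m⟩ = Complex.I * m := by
    rw [GaussianInt.toComplex_def]
    simp [mul_comm]
  have h4 : ((splitQ e (k + 1) (n + 1) : GaussianInt) : ℂ) = splitQ e (k + 1) (n + 1) := by simp
  rw [map_mul, h4, splitP, map_pow, h3]
  simp only [Nat.add_sub_cancel]
  push_cast
  rw [pow_mul]
  field_simp
  rw [← mul_pow]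
  congr 1
  field_simp

/-- The remainder of the exponential series after `n + 1` terms, where `expWeight h n ≥ W`. -/
theorem exp_tail_le {m : ℤ} {e h n W : ℕ} (hm : 0 ≤ m) (hm' : m ≤ 2 ^ (e - h)) (he : h ≤ e)
    (hn : W ≤ expWeight h n) :
    ‖Complex.exp (Complex.I * ((m : ℝ) / 2 ^ e : ℝ)) -
      ∑ k ∈ Finset.range (n + 1),
        (Complex.I * ((m : ℝ) / 2 ^ e : ℝ)) ^ k / (k.factorial : ℂ)‖ ≤ 2 * (1 / 2 ^ W) := by
  have hr : (m : ℝ) / 2 ^ e ≤ 1 / 2 ^ h := by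
    rw [div_le_div_iff₀ (by positivity) (by positivity), one_mul]
    calc (m : ℝ) * 2 ^ h ≤ 2 ^ (e - h) * 2 ^ h := by gcongr; exact_mod_cast hm'
      _ = 2 ^ e := by rw [← pow_add, Nat.sub_add_cancel he]
  have hr0 : 0 ≤ (m : ℝ) / 2 ^ e := by positivity
  generalize (m : ℝ) / 2 ^ e = r at *
  have hr1 : r ≤ 1 := hr.trans (by
    rw [div_le_one (by positivity)]; exact one_le_pow₀ (by norm_num))
  have hnorm : ‖Complex.I * (r : ℂ)‖ = r := by simp [abs_of_nonneg hr0]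
  refine (Complex.exp_bound (hnorm.trans_le hr1) (Nat.succ_pos n)).trans ?_
  rw [hnorm]
  have hfac : (0 : ℝ) < n.factorial := by exact_mod_cast n.factorial_pos
  have hw : (2 : ℝ) ^ W ≤ n.factorial * (2 ^ h) ^ n := by
    rw [← pow_mul]
    exact_mod_cast (Nat.pow_le_pow_right (by norm_num) hn).trans (two_pow_expWeight_le h n)
  have h1 : r ^ n ≤ 1 / (2 ^ h) ^ n := by
    rw [← one_div_pow]; exact pow_le_pow_left₀ hr0 hr n
  have h2 : r ^ (n + 1) ≤ 1 / (2 ^ h) ^ n := by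
    rw [pow_succ]
    have : 0 ≤ r ^ n := by positivity
    nlinarith
  have h3 : ((n.succ.succ : ℕ) : ℝ) * ((n.succ.factorial : ℝ) * (n.succ : ℕ))⁻¹ ≤
      2 / n.factorial := by
    rw [← div_eq_mul_inv, div_le_div_iff₀ (by positivity) hfac, Nat.factorial_succ]
    push_cast
    have : (0 : ℝ) ≤ n := by positivity
    nlinarith [mul_nonneg hfac.le this, mul_nonneg (mul_nonneg hfac.le this) this]
  calc _ ≤ 1 / (2 ^ h : ℝ) ^ n * (2 / n.factorial) := by
        refine mul_le_mul h2 h3 (by positivity) (by positivity)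
    _ = 2 * (1 / (n.factorial * (2 ^ h) ^ n)) := by field_simp
    _ ≤ _ := by gcongr

/-- The complex number whose real and imaginary parts, with `W` fractional bits, are stored as the
integers `a` and `b`. -/
noncomputable def fixedComplex (W : ℕ) (a b : ℤ) : ℂ := ⟨fixedPoint W a, fixedPoint W b⟩

/-- `exp (i m / 2 ^ e)` with `W` fractional bits, from `m`, `e`, `h`, `W`, where `m < 2 ^ (e - h)`:
a partial sum of the exponential series by binary splitting and one division. -/
def expI (mul : Prog) : Prog :=
  .seq (.call [4] termCount [3, 2]) <|
  .seq (.const 5 1) <|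
  .seq (.call [6, 7, 8, 9, 10] (binarySplit mul) [5, 4, 0, 1]) <|
  .seq (.call [11] (reciprocal mul) [8, 3]) <|
  .seq (.len 12 8) <|
  .seq (.call [9] mul [9, 11]) <|
  .seq (.shr 0 9 12) <|
  .seq (.call [10] mul [10, 11]) <|
  .seq (.shr 1 10 12) <|
  .seq (.shl 5 5 3) <|
  .add 0 0 5

/-- For the number of terms chosen by `termCount`, the numerator and the denominator of the partial
sum have `O(W + h)` bits. -/
theorem splitWeight_le {e h n W : ℕ} (he : e ≤ 2 * h + 1) (hn1 : 1 ≤ n) (hn : n ≤ W + 1)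
    (hW : expWeight h (n - 1) < W) : splitWeight e 1 (n + 1) ≤ 7 * W + 2 * h + 3 := by
  have h1 : ∀ k, splitWeight e 1 (k + 1) ≤ 2 * expWeight h k + 3 * k := by
    intro k
    induction k with
    | zero => simp [splitWeight]
    | succ k ih =>
      have := one_le_bits (Nat.succ_pos k)
      rw [splitWeight_succ e (by omega), expWeight_succ]
      omega
  obtain ⟨k, rfl⟩ := Nat.exists_eq_add_of_le' hn1
  have h2 := h1 (k + 1)
  have h3 := expWeight_succ h k
  have h4 := bits_natCast_le (k + 1)
  rw [Nat.add_sub_cancel] at hW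
  omega

/-- The effect of truncation on the product of a number `t / Q` with the approximate reciprocal
`Y` of `Q`. -/
theorem abs_fixedPoint_mul_ediv_sub_le {Q t Y : ℤ} {q W : ℕ} {B : ℝ} (hQ : 0 < Q)
    (hY : |defect Q q W Y| ≤ 5 * (1 / 2 ^ W)) (ht : |(t : ℝ) / Q| ≤ B) :
    |fixedPoint W (t * Y / 2 ^ q) - t / Q| ≤ (5 * B + 1) * (1 / 2 ^ W) := by
  obtain ⟨θ, h₁, h₂, h₃⟩ := exists_ediv_two_pow (t * Y) q
  have hQ' : (0 : ℝ) < Q := by exact_mod_cast hQ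
  have hW : (0 : ℝ) < 2 ^ W := by positivity
  have e : fixedPoint W (t * Y / 2 ^ q) - t / Q =
      -(t / Q * defect Q q W Y) - θ * (1 / 2 ^ W) := by
    unfold fixedPoint defect
    rw [h₃]
    push_cast
    field_simp
    ring
  have h4 : |(t : ℝ) / Q * defect Q q W Y| ≤ B * (5 * (1 / 2 ^ W)) := by
    rw [abs_mul]
    exact mul_le_mul ht hY (abs_nonneg _) ((abs_nonneg _).trans ht)
  have h5 : 0 ≤ θ * (1 / 2 ^ W : ℝ) := by positivity
  have h6 : θ * (1 / 2 ^ W : ℝ) ≤ 1 * (1 / 2 ^ W) := by gcongr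
  rw [e]
  rw [abs_le] at *
  constructor <;> linarith

theorem computes_expI {mul : Prog} {m p₁ p₂ Q r i Y : ℤ} {e h W n T₁ T₂ T₃ T₄ S : ℕ}
    (h₁ : Computes termCount [(W : ℤ), (h : ℤ)] [((n + 1 : ℕ) : ℤ)] T₁)
    (h₂ : Computes (binarySplit mul) [((1 : ℕ) : ℤ), ((n + 1 : ℕ) : ℤ), m, (e : ℤ)]
      [p₁, p₂, Q, r, i] T₂)
    (h₃ : Computes (reciprocal mul) [Q, (W : ℤ)] [Y] T₃)
    (h₄ : Computes mul [r, Y] [r * Y] T₄) (h₅ : Computes mul [i, Y] [i * Y] T₄)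
    (hW : W + 1 ≤ S) (hh : bits (h : ℤ) ≤ S) (he : bits (e : ℤ) ≤ S)
    (hn : bits ((n + 1 : ℕ) : ℤ) ≤ S)
    (hm : bits m ≤ S) (hp₁ : bits p₁ ≤ S) (hp₂ : bits p₂ ≤ S) (hQ : bits Q ≤ S) (hr : bits r ≤ S)
    (hi : bits i ≤ S) (hY : bits Y ≤ S) :
    Computes (expI mul) [m, (e : ℤ), (h : ℤ), (W : ℤ)]
      [r * Y / 2 ^ bits Q + 2 ^ W, i * Y / 2 ^ bits Q] (T₁ + T₂ + T₃ + 2 * T₄ + 100 * S) := by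
  have b1 : bits (W : ℤ) ≤ S := (bits_natCast_le W).trans (by omega)
  have b6 : bits ((bits Q : ℕ) : ℤ) ≤ S := (bits_natCast_le _).trans hQ
  have b7 := bits_mul_le r Y
  have b8 := bits_mul_le i Y
  have b9 := bits_pow_two_le W
  have b10 := bits_ediv_le (r * Y) (bits Q)
  push_cast at h₁ h₂ hn
  refine Wp.computes_of_forall fun s => ?_
  rw [frame_pad _ 9]
  simp [expI]
  refine Wp.call h₁ rfl le_rfl fun t₁ ht₁ => ?_
  simp [passCost, List.range, List.range.loop]
  refine Wp.call h₂ rfl le_rfl fun t₂ ht₂ => ?_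
  simp [passCost, List.range, List.range.loop]
  refine Wp.call h₃ rfl le_rfl fun t₃ ht₃ => ?_
  simp [passCost, List.range, List.range.loop]
  refine Wp.call h₄ rfl le_rfl fun t₄ ht₄ => ?_
  simp [passCost, List.range, List.range.loop]
  refine Wp.call h₅ rfl le_rfl fun t₅ ht₅ => ?_
  simp [passCost, List.range, List.range.loop]
  constructor
  · omega
  · intro i hi
    interval_cases i <;> simp

theorem norm_fixedComplex_sub_exp_le {T : GaussianInt} {Q Y : ℤ} {q W : ℕ} {z E : ℂ} (hQ : 0 < Q)
    (hW : 1 ≤ W) (hz : z = (T : ℂ) / Q) (hYd : |defect Q q W Y| ≤ 5 * (1 / 2 ^ W))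
    (hexp : ‖E‖ = 1) (htail : ‖E - (z + 1)‖ ≤ 2 * (1 / 2 ^ W)) :
    ‖fixedComplex W (T.re * Y / 2 ^ q + 2 ^ W) (T.im * Y / 2 ^ q) - E‖ ≤ 40 * (1 / 2 ^ W) := by
  have hzre : z.re = T.re / Q := by
    rw [hz, GaussianInt.toComplex_def, ← Complex.ofReal_intCast Q, Complex.div_ofReal_re]
    simp
  have hzim : z.im = T.im / Q := by
    rw [hz, GaussianInt.toComplex_def, ← Complex.ofReal_intCast Q, Complex.div_ofReal_im]
    simp
  have hε : (1 : ℝ) / 2 ^ W ≤ 1 / 2 := by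
    simpa using one_div_pow_le_one_div_pow_of_le (a := (2 : ℝ)) (by norm_num)
      hW
  have hz3 : ‖z‖ ≤ 3 := by
    calc ‖z‖ = ‖E - (E - (z + 1)) - 1‖ := by ring_nf
      _ ≤ ‖E - (E - (z + 1))‖ + ‖(1 : ℂ)‖ := norm_sub_le _ _
      _ ≤ ‖E‖ + ‖E - (z + 1)‖ + ‖(1 : ℂ)‖ := by gcongr; exact norm_sub_le _ _
      _ ≤ 3 := by rw [hexp, norm_one]; linarith
  have h1 := abs_fixedPoint_mul_ediv_sub_le hQ hYd
    (hzre ▸ (Complex.abs_re_le_norm z).trans hz3)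
  have h2 := abs_fixedPoint_mul_ediv_sub_le hQ hYd
    (hzim ▸ (Complex.abs_im_le_norm z).trans hz3)
  rw [← hzre] at h1
  rw [← hzim] at h2
  have h3 : fixedPoint W (T.re * Y / 2 ^ q + 2 ^ W) =
      fixedPoint W (T.re * Y / 2 ^ q) + 1 := by
    have : (0 : ℝ) < 2 ^ W := by positivity
    unfold fixedPoint
    push_cast
    field_simp
  set F := fixedComplex W (T.re * Y / 2 ^ q + 2 ^ W) (T.im * Y / 2 ^ q)
  have h4 : ‖F - (z + 1)‖ ≤ 32 * (1 / 2 ^ W) := by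
    refine (Complex.norm_le_abs_re_add_abs_im _).trans ?_
    have e1 : (F - (z + 1)).re = fixedPoint W (T.re * Y / 2 ^ q) - z.re := by
      simp [F, fixedComplex, h3]
    have e2 : (F - (z + 1)).im = fixedPoint W (T.im * Y / 2 ^ q) - z.im := by
      simp [F, fixedComplex]
    rw [e1, e2]
    linarith
  calc ‖F - E‖ = ‖(F - (z + 1)) - (E - (z + 1))‖ := by ring_nf
    _ ≤ _ := norm_sub_le _ _
    _ ≤ _ := by
      have : (0 : ℝ) < 1 / 2 ^ W := by positivity
      linarith

theorem exists_expI {mul : Prog} {L : ℕ → ℕ} (hmul : FastMul mul L) {m : ℤ} {e h W : ℕ}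
    (hm : 0 ≤ m) (hm' : m < 2 ^ (e - h)) (he : h ≤ e) (he' : e ≤ 2 * h + 1) (hW : 5 ≤ W)
    (heW : e ≤ W) :
    ∃ a b : ℤ, Computes (expI mul) [m, (e : ℤ), (h : ℤ), (W : ℤ)] [a, b]
        (3000 * bits (W : ℤ) * L (10 * W)) ∧
      ‖fixedComplex W a b - Complex.exp (Complex.I * ((m : ℝ) / 2 ^ e : ℝ))‖ ≤
        40 * (1 / 2 ^ W) := by
  obtain ⟨n, hn1, hnW, hn, hlast, hterm⟩ := exists_termCount W h (by omega)
  have hbm : bits m ≤ e := bits_le.2 (by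
    rw [abs_of_nonneg hm]
    exact hm'.trans_le (pow_le_pow_right₀ (by norm_num) (by omega)))
  have hw := splitWeight_le he' hn1 hnW hlast
  have hQ := splitQ_pos e le_rfl (n + 1)
  have hQw := splitQ_lt e (show 1 < n + 1 by omega)
  have hTw := taxi_splitT_lt hbm (show 1 ≤ n + 1 by omega)
  have hPw := taxi_splitP_lt hbm (show 1 < n + 1 by omega)
  have hbs := hmul.binarySplit hbm (bits (n : ℤ)) 1 (n + 1) (by omega) (by
    have := abs_lt_two_pow_bits (n : ℤ)
    rw [abs_of_nonneg (by positivity)] at this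
    have : n < 2 ^ bits (n : ℤ) := by exact_mod_cast this
    omega)
  have htail := exp_tail_le hm hm'.le he hn
  have hz : ∃ z : ℂ, z = (splitT m e 1 (n + 1) : ℂ) / splitQ e 1 (n + 1) := ⟨_, rfl⟩
  obtain ⟨z, hz⟩ := hz
  have hz' := hz.trans (splitT_div_splitQ m e n)
  have hwS : splitWeight e 1 (n + 1) ≤ 10 * W := by omega
  have hLw := hmul.mono hwS
  have hLW := hmul.le_self (10 * W)
  have hpw : (2 : ℤ) ^ splitWeight e 1 (n + 1) ≤ 2 ^ (10 * W) :=
    pow_le_pow_right₀ (by norm_num) hwS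
  replace hTw := hTw.trans_le hpw
  replace hPw := hPw.trans_le hpw
  replace hQw := hQw.trans_le hpw
  generalize splitT m e 1 (n + 1) = T at *
  generalize splitP m 1 (n + 1) = P at *
  generalize splitQ e 1 (n + 1) = Q at *
  have hQS : bits Q ≤ 10 * W := bits_le.2 (by rwa [abs_of_nonneg hQ.le])
  obtain ⟨Y, hrec, hYb, hYd⟩ := exists_reciprocal hmul hQ hW hQS (by omega)
  refine ⟨T.re * Y / 2 ^ bits Q + 2 ^ W, T.im * Y / 2 ^ bits Q, ?_, ?_⟩
  · obtain ⟨N, hN⟩ : ∃ N, bits (W : ℤ) = N := ⟨_, rfl⟩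
    have hN1 : 1 ≤ N := hN ▸ one_le_bits (by omega)
    have hN4 : ∀ k : ℕ, k ≤ 4 * W → bits (k : ℤ) ≤ N + 2 := fun k hk => by
      rw [← hN]
      refine le_trans (bits_nonneg_mono (by positivity) ?_) (bits_mul_two_pow_le (W : ℤ) 2)
      push_cast
      omega
    have b2 := hN4 (W + h + 2) (by omega)
    have b3 := hN4 n (by omega)
    have b4 := (bits_natCast_le h).trans (show h ≤ 10 * W by omega)
    have b5 := (bits_natCast_le e).trans (show e ≤ 10 * W by omega)
    have b6 := (bits_natCast_le (n + 1)).trans (show n + 1 ≤ 10 * W by omega)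
    have c₁ : 60 * (W + 2) * bits ((W + h + 2 : ℕ) : ℤ) ≤ 60 * (2 * W) * (3 * N) := by
      gcongr <;> omega
    have c₂ : 300 * (bits (n : ℤ) + 1) * L (splitWeight e 1 (n + 1)) ≤
        300 * (4 * N) * L (10 * W) := by
      gcongr
      omega
    have c₃ : W * N ≤ L (10 * W) * N := Nat.mul_le_mul_right N (by omega)
    have c₄ : L (10 * W) * 1 ≤ L (10 * W) * N := Nat.mul_le_mul_left _ hN1
    refine (computes_expI hterm hbs hrec
      (hmul.multiplies (10 * W) (by omega) T.re Y (bits_re_le hTw) (by omega))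
      (hmul.multiplies (10 * W) (by omega) T.im Y (bits_im_le hTw) (by omega))
      (S := 10 * W) (by omega) b4 b5 b6 (by omega) (bits_re_le hPw) (bits_im_le hPw) hQS
      (bits_re_le hTw) (bits_im_le hTw) (by omega)).mono ?_
    rw [hN]
    have r₁ : 60 * (2 * W) * (3 * N) = 360 * (W * N) := by ring
    have r₂ : 300 * (4 * N) * L (10 * W) = 1200 * (L (10 * W) * N) := by ring
    have r₃ : N * (60 * L (10 * W)) = 60 * (L (10 * W) * N) := by ring
    have r₄ : 3000 * N * L (10 * W) = 3000 * (L (10 * W) * N) := by ring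
    omega
  · refine norm_fixedComplex_sub_exp_le hQ (by omega) hz hYd ?_ ?_
    · rw [mul_comm]
      exact Complex.norm_exp_ofReal_mul_I _
    · rwa [hz', sub_add_cancel]

/-! ### The sine by bit bursts -/

theorem bits_le_of_norm_le {W : ℕ} {a b : ℤ} (h : ‖fixedComplex W a b‖ ≤ 2) :
    bits a ≤ W + 2 ∧ bits b ≤ W + 2 := by
  have hW : (0 : ℝ) < 2 ^ W := by positivity
  have key : ∀ c : ℤ, |fixedPoint W c| ≤ 2 → bits c ≤ W + 2 := fun c hc => by
    rw [fixedPoint, abs_div, abs_of_pos hW, div_le_iff₀ hW] at hc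
    rw [bits_le, pow_add]
    have : |(c : ℝ)| < 2 ^ W * 2 ^ 2 := by linarith
    exact_mod_cast this
  exact ⟨key a ((Complex.abs_re_le_norm _).trans h), key b ((Complex.abs_im_le_norm _).trans h)⟩

/-- The product of two complex numbers with `W` fractional bits, again with `W` fractional bits. -/
def truncMul (mul : Prog) : Prog :=
  .seq (.call [0, 1] (complexMul mul) [0, 1, 2, 3]) <|
  .seq (.shr 0 0 4) <|
  .shr 1 1 4

theorem exists_truncMul {mul : Prog} {L : ℕ → ℕ} (hmul : FastMul mul L) {a b c d : ℤ} {W : ℕ}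
    (hW : 1 ≤ W) (h₁ : ‖fixedComplex W a b‖ ≤ 2) (h₂ : ‖fixedComplex W c d‖ ≤ 2) :
    ∃ x y : ℤ, Computes (truncMul mul) [a, b, c, d, (W : ℤ)] [x, y] (100 * L (10 * W)) ∧
      ‖fixedComplex W x y - fixedComplex W a b * fixedComplex W c d‖ ≤ 2 * (1 / 2 ^ W) := by
  obtain ⟨ba, bb⟩ := bits_le_of_norm_le h₁
  obtain ⟨bc, bd⟩ := bits_le_of_norm_le h₂
  refine ⟨(a * c - b * d) / 2 ^ W, (a * d + b * c) / 2 ^ W, ?_, ?_⟩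
  · have hc := hmul.complexMul (s := 3 * W) (by omega) (ba.trans (by omega)) (bb.trans (by omega))
      (bc.trans (by omega)) (bd.trans (by omega))
    have hL := hmul.mono (show 3 * W ≤ 10 * W by omega)
    have hL' := hmul.le_self (10 * W)
    have b1 := bits_natCast_le W
    have b2 : bits (a * c - b * d) ≤ 6 * W + 1 :=
      bits_sub_le ((bits_mul_le a c).trans (by omega)) ((bits_mul_le b d).trans (by omega))
    have b3 : bits (a * d + b * c) ≤ 6 * W + 1 :=
      bits_add_le ((bits_mul_le a d).trans (by omega)) ((bits_mul_le b c).trans (by omega))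
    refine Wp.computes_of_forall fun s => ?_
    simp [truncMul]
    refine Wp.call hc rfl le_rfl fun t₁ ht₁ => ?_
    simp [passCost, List.range, List.range.loop]
    constructor
    · omega
    · intro i hi
      interval_cases i <;> simp
  · obtain ⟨θ₁, h₁, h₂, h₃⟩ := exists_ediv_two_pow (a * c - b * d) W
    obtain ⟨θ₂, h₄, h₅, h₆⟩ := exists_ediv_two_pow (a * d + b * c) W
    have hW : (0 : ℝ) < 2 ^ W := by positivity
    have e : fixedComplex W ((a * c - b * d) / 2 ^ W) ((a * d + b * c) / 2 ^ W) -
        fixedComplex W a b * fixedComplex W c d =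
        ⟨-(θ₁ * (1 / 2 ^ W)), -(θ₂ * (1 / 2 ^ W))⟩ := by
      apply Complex.ext
      · simp only [fixedComplex, fixedPoint, h₃, Complex.sub_re, Complex.mul_re]
        push_cast
        field_simp
        ring
      · simp only [fixedComplex, fixedPoint, h₆, Complex.sub_im, Complex.mul_im]
        push_cast
        field_simp
        ring
    rw [e]
    refine (Complex.norm_le_abs_re_add_abs_im _).trans ?_
    simp only [abs_neg]
    rw [abs_of_nonneg (by positivity), abs_of_nonneg (by positivity)]
    have : (0 : ℝ) < 1 / 2 ^ W := by positivity
    nlinarith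

/-- The bit burst loop. Cell `2` holds the number `W` of fractional bits of the results, cell `3`
the constant `1`, cells `4` and `13` the remaining argument `A / 2 ^ e`, and cells `5` and `6` the
product of the exponentials computed so far. Each pass cuts off the bits of `A / 2 ^ e` after the
first `⌊e / 2⌋` ones. -/
def burstLoop (mul : Prog) : Prog :=
  .loop 4 <|
    .seq (.shr 7 4 3) <|
    .seq (.sub 8 4 7) <|
    .seq (.shr 9 13 8) <|
    .seq (.shl 10 9 8) <|
    .seq (.sub 10 13 10) <|
    .seq (.call [11, 12] (expI mul) [10, 4, 7, 2]) <|
    .seq (.call [5, 6] (truncMul mul) [5, 6, 11, 12, 2]) <|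
    .seq (.move 13 9) <|
    .move 4 7

/-- From `p` and `a`, with `x = a / 2 ^ p` in `(0, 8)`, compute `x + sin x` with `3 * p` fractional
bits. With `W = 8 * p + 64` fractional bits, first `exp (i x / 8)` is computed as a product of
values at numbers with few bits: the first halves of the binary expansion are cut off again and
again. Then this value is raised to the eighth power. -/
def sineStep (mul : Prog) : Prog :=
  .seq (.const 3 3) <|
  .seq (.add 4 0 3) <|
  .seq (.shl 2 0 3) <|
  .seq (.const 3 64) <|
  .seq (.add 2 2 3) <|
  .seq (.const 3 1) <|
  .seq (.shl 5 3 2) <|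
  .seq (.move 13 1) <|
  .seq (burstLoop mul) <|
  .seq (.call [5, 6] (truncMul mul) [5, 6, 5, 6, 2]) <|
  .seq (.call [5, 6] (truncMul mul) [5, 6, 5, 6, 2]) <|
  .seq (.call [5, 6] (truncMul mul) [5, 6, 5, 6, 2]) <|
  .seq (.add 8 0 0) <|
  .seq (.sub 7 2 8) <|
  .seq (.sub 7 7 0) <|
  .seq (.sub 9 7 3) <|
  .seq (.shl 9 3 9) <|
  .seq (.add 6 6 9) <|
  .seq (.shr 6 6 7) <|
  .seq (.shl 0 1 8) <|
  .add 0 0 6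

/-- The effect of one pass of the main loop, which splits off the low-order half of the bits of the
argument `A / 2 ^ e`. -/
theorem norm_burst_le {W e h : ℕ} {A : ℤ} {F G F' E : ℂ} {η : ℝ} (he : h ≤ e)
    (hF : ‖F‖ ≤ 2)
    (hη : ‖F * Complex.exp (Complex.I * ((A : ℝ) / 2 ^ e : ℝ)) - E‖ ≤ η)
    (hG : ‖G - Complex.exp (Complex.I *
      (((A - A / 2 ^ (e - h) * 2 ^ (e - h) : ℤ) : ℝ) / 2 ^ e : ℝ))‖ ≤ 40 * (1 / 2 ^ W))
    (hF' : ‖F' - F * G‖ ≤ 2 * (1 / 2 ^ W)) :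
    ‖F' * Complex.exp (Complex.I * (((A / 2 ^ (e - h) : ℤ) : ℝ) / 2 ^ h : ℝ)) - E‖ ≤
      η + 82 * (1 / 2 ^ W) := by
  have hexp : Complex.exp (Complex.I * ((A : ℝ) / 2 ^ e : ℝ)) =
      Complex.exp (Complex.I *
        (((A - A / 2 ^ (e - h) * 2 ^ (e - h) : ℤ) : ℝ) / 2 ^ e : ℝ)) *
      Complex.exp (Complex.I * (((A / 2 ^ (e - h) : ℤ) : ℝ) / 2 ^ h : ℝ)) := by
    rw [← Complex.exp_add, ← mul_add, ← Complex.ofReal_add]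
    congr 3
    have : (2 : ℝ) ^ e = 2 ^ (e - h) * 2 ^ h := by rw [← pow_add, Nat.sub_add_cancel he]
    rw [this]
    push_cast
    field_simp
    ring
  rw [hexp] at hη
  have hH : ‖Complex.exp (Complex.I * (((A / 2 ^ (e - h) : ℤ) : ℝ) / 2 ^ h : ℝ))‖ = 1 := by
    rw [mul_comm]
    exact Complex.norm_exp_ofReal_mul_I _
  generalize Complex.exp (Complex.I *
        (((A - A / 2 ^ (e - h) * 2 ^ (e - h) : ℤ) : ℝ) / 2 ^ e : ℝ)) = K at *
  generalize Complex.exp (Complex.I * (((A / 2 ^ (e - h) : ℤ) : ℝ) / 2 ^ h : ℝ)) = H at *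
  have hε : (0 : ℝ) < 1 / 2 ^ W := by positivity
  calc ‖F' * H - E‖ = ‖(F * (K * H) - E) + F * (G - K) * H + (F' - F * G) * H‖ := by ring_nf
    _ ≤ ‖F * (K * H) - E‖ + ‖F * (G - K) * H‖ + ‖(F' - F * G) * H‖ := norm_add₃_le
    _ = ‖F * (K * H) - E‖ + ‖F‖ * ‖G - K‖ + ‖F' - F * G‖ := by
      simp only [norm_mul, hH, mul_one]
    _ ≤ η + 2 * (40 * (1 / 2 ^ W)) + 2 * (1 / 2 ^ W) := by gcongr
    _ = _ := by ring

theorem norm_square_le {F F' E : ℂ} {η ε : ℝ} (hE : ‖E‖ = 1) (hη : ‖F - E‖ ≤ η) (hη1 : η ≤ 1)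
    (hF' : ‖F' - F * F‖ ≤ 2 * ε) : ‖F' - E * E‖ ≤ 3 * η + 2 * ε := by
  have hF : ‖F‖ ≤ 2 := by
    calc ‖F‖ = ‖F - E + E‖ := by ring_nf
      _ ≤ ‖F - E‖ + ‖E‖ := norm_add_le _ _
      _ ≤ 2 := by linarith
  calc ‖F' - E * E‖ = ‖(F' - F * F) + (F + E) * (F - E)‖ := by ring_nf
    _ ≤ ‖F' - F * F‖ + ‖F + E‖ * ‖F - E‖ := by rw [← norm_mul]; exact norm_add_le _ _
    _ ≤ 2 * ε + 3 * η := by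
      gcongr
      exact (norm_add_le _ _).trans (by linarith)
    _ = _ := by ring

/-- The final rounding of the sine, from `W` to `3 * p` fractional bits. -/
theorem abs_round_sub_le {p g : ℕ} {a S : ℤ} {s : ℝ} (hg : 1 ≤ g)
    (hS : |fixedPoint (3 * p + g) S - s| ≤ 1 / 4 * (1 / 2 ^ (3 * p))) :
    |fixedPoint (3 * p) (a * 2 ^ (2 * p) + (S + 2 ^ (g - 1)) / 2 ^ g) - (fixedPoint p a + s)| ≤
      3 / 4 * (1 / 2 ^ (3 * p)) := by
  obtain ⟨θ, h₁, h₂, h₃⟩ := exists_ediv_two_pow (S + 2 ^ (g - 1)) g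
  have hp : (0 : ℝ) < 2 ^ p := by positivity
  have hg2 : (2 : ℝ) ^ g = 2 * 2 ^ (g - 1) := by
    rw [← pow_succ', Nat.sub_add_cancel hg]
  have h4 : (0 : ℝ) < 2 ^ (g - 1) := by positivity
  have e : fixedPoint (3 * p) (a * 2 ^ (2 * p) + (S + 2 ^ (g - 1)) / 2 ^ g) -
      (fixedPoint p a + s) =
      (fixedPoint (3 * p + g) S - s) + (1 / 2 - θ) * (1 / 2 ^ (3 * p)) := by
    unfold fixedPoint
    push_cast
    rw [h₃]
    push_cast
    rw [pow_add, hg2, show 3 * p = 2 * p + p by ring, pow_add]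
    field_simp
    ring
  have hε : (0 : ℝ) < 1 / 2 ^ (3 * p) := by positivity
  rw [e]
  generalize (1 : ℝ) / 2 ^ (3 * p) = ε at *
  rw [abs_le] at *
  constructor <;> nlinarith

/-- The product of the exponential of the remaining argument with the number in the cells `5` and `6`
is an invariant of the loop, up to an error of `82` units in the last place per pass. The argument
becomes zero after `bits e₀` passes. -/
theorem wp_burstLoop {mul s : Prog} {L : ℕ → ℕ} (hmul : FastMul mul L) {W e₀ : ℕ} {A₀ p a : ℤ}
    {c : ℕ} {Q : Mem → ℕ → Prop} (hW : 6 ≤ W) (he₀ : e₀ ≤ W) (hA₀ : 0 ≤ A₀) (hA₀' : A₀ < 2 ^ e₀)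
    (hN : 82 * (bits (e₀ : ℤ) : ℝ) * (1 / 2 ^ W) ≤ 1)
    (hQ : ∀ (C S x₇ x₈ x₉ x₁₀ x₁₁ x₁₂ x₁₃ : ℤ) (t : ℕ),
      ‖fixedComplex W C S - Complex.exp (Complex.I * ((A₀ : ℝ) / 2 ^ e₀ : ℝ))‖ ≤
        82 * (bits (e₀ : ℤ) : ℝ) * (1 / 2 ^ W) →
      t ≤ c + bits (e₀ : ℤ) * (3200 * (bits (W : ℤ) * L (10 * W))) + 1 →
      Q (frame [p, a, (W : ℤ), 1, 0, C, S, x₇, x₈, x₉, x₁₀, x₁₁, x₁₂, x₁₃]) t) :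
    Wp s (burstLoop mul) (frame [p, a, (W : ℤ), 1, (e₀ : ℤ), 2 ^ W, 0, 0, 0, 0, 0, 0, 0, A₀]) c
      Q := by
  have hW0 : (0 : ℝ) < 2 ^ W := by positivity
  have hε : (0 : ℝ) < 1 / 2 ^ W := by positivity
  have hL := hmul.le_self (10 * W)
  have hlam : 1 ≤ bits (W : ℤ) := one_le_bits (by omega)
  have hlamL : L (10 * W) * 1 ≤ L (10 * W) * bits (W : ℤ) := Nat.mul_le_mul_left _ hlam
  have hbW := bits_natCast_le W
  obtain ⟨N, hNe⟩ : ∃ N, bits (e₀ : ℤ) = N := ⟨_, rfl⟩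
  rw [hNe] at hN hQ
  have h40 : 40 * (1 / 2 ^ W : ℝ) ≤ 1 := by
    have : (1 : ℝ) / 2 ^ W ≤ 1 / 2 ^ 6 := one_div_pow_le_one_div_pow_of_le (by norm_num) hW
    linarith
  have hexp : ∀ x : ℝ, ‖Complex.exp (Complex.I * (x : ℂ))‖ = 1 := fun x => by
    rw [mul_comm]; exact Complex.norm_exp_ofReal_mul_I x
  set E := Complex.exp (Complex.I * ((A₀ : ℝ) / 2 ^ e₀ : ℝ)) with hE
  have hE1 : ‖E‖ = 1 := hexp _
  -- the invariant is kept opaque, so that the simplifier does not take it apart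
  obtain ⟨I, hI⟩ : ∃ I : ℕ → Mem → ℕ → Prop, ∀ j τ t, I j τ t ↔
      ∃ (i e : ℕ) (A C S x₇ x₈ x₉ x₁₀ x₁₁ x₁₂ : ℤ), i + j = N ∧ e = e₀ / 2 ^ i ∧ 0 ≤ A ∧
        A < 2 ^ e ∧
        ‖fixedComplex W C S * Complex.exp (Complex.I * ((A : ℝ) / 2 ^ e : ℝ)) - E‖ ≤
          82 * (i : ℝ) * (1 / 2 ^ W) ∧
        τ = frame [p, a, (W : ℤ), 1, (e : ℤ), C, S, x₇, x₈, x₉, x₁₀, x₁₁, x₁₂, A] ∧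
        t ≤ c + i * (3200 * (bits (W : ℤ) * L (10 * W))) := ⟨_, fun _ _ _ => Iff.rfl⟩
  refine Wp.loop I ?_ ?_ N _ _ ?_
  · intro j τ t h
    obtain ⟨i, e, A, C, S, x₇, x₈, x₉, x₁₀, x₁₁, x₁₂, hij, he, hA, hA', herr, rfl, ht⟩ :=
      (hI _ _ _).1 h
    have he1 : 1 ≤ e := by
      rw [he, Nat.le_div_iff_mul_le (by positivity), one_mul]
      have h1 : i < bits (e₀ : ℤ) := by omega
      simpa [bits] using Nat.lt_size.1 h1
    have heW : e ≤ W := by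
      rw [he]
      exact (Nat.div_le_self _ _).trans he₀
    obtain ⟨h, hh⟩ : ∃ h, e / 2 = h := ⟨_, rfl⟩
    have hh' : h = e₀ / 2 ^ (i + 1) := by
      rw [← hh, he, Nat.div_div_eq_div_mul, pow_succ]
    have hhz : (e : ℤ) / 2 = h := by omega
    have hez : (e : ℤ) - h = ((e - h : ℕ) : ℤ) := by omega
    have hpd : (0 : ℤ) < 2 ^ (e - h) := by positivity
    have hi : (i : ℝ) ≤ N := by
      have : i ≤ N := by omega
      exact_mod_cast this
    have hF : ‖fixedComplex W C S‖ ≤ 2 := by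
      have h1 : ‖fixedComplex W C S * Complex.exp (Complex.I * ((A : ℝ) / 2 ^ e : ℝ))‖ ≤ 2 := by
        calc _ = ‖fixedComplex W C S * Complex.exp (Complex.I * ((A : ℝ) / 2 ^ e : ℝ)) - E + E‖ :=
              by ring_nf
          _ ≤ _ := norm_add_le _ _
          _ ≤ 2 := by
            have : 82 * (i : ℝ) * (1 / 2 ^ W) ≤ 82 * (N : ℝ) * (1 / 2 ^ W) := by gcongr
            linarith
      rwa [norm_mul, hexp, mul_one] at h1
    have hlo : 0 ≤ A - A / 2 ^ (e - h) * 2 ^ (e - h) := by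
      have := Int.ediv_mul_le A hpd.ne'
      linarith
    have hlo' : A - A / 2 ^ (e - h) * 2 ^ (e - h) < 2 ^ (e - h) := by
      have := Int.lt_ediv_add_one_mul_self A hpd
      linarith
    have hhi : 0 ≤ A / 2 ^ (e - h) := Int.ediv_nonneg hA hpd.le
    have hhi' : A / 2 ^ (e - h) < 2 ^ h := by
      refine Int.ediv_lt_of_lt_mul hpd ?_
      rwa [← pow_add, Nat.add_sub_cancel' (by omega)]
    obtain ⟨x, y, hexpI, hG⟩ := exists_expI hmul hlo hlo' (by omega : h ≤ e) (by omega)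
      (by omega : 5 ≤ W) heW
    have hG2 : ‖fixedComplex W x y‖ ≤ 2 := by
      have h1 := norm_le_norm_add_norm_sub' (fixedComplex W x y) (Complex.exp (Complex.I *
        (((A - A / 2 ^ (e - h) * 2 ^ (e - h) : ℤ) : ℝ) / 2 ^ e : ℝ)))
      rw [hexp] at h1
      linarith
    obtain ⟨C', S', hmulI, hF'⟩ := exists_truncMul hmul (by omega : 1 ≤ W) hF hG2
    have hnext := norm_burst_le (by omega : h ≤ e) hF herr hG hF'
    obtain ⟨bC, bS⟩ := bits_le_of_norm_le hF
    obtain ⟨bx, bby⟩ := bits_le_of_norm_le hG2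
    have hF2 : ‖fixedComplex W C' S'‖ ≤ 2 := by
      have h1 : ‖fixedComplex W C' S' *
          Complex.exp (Complex.I * (((A / 2 ^ (e - h) : ℤ) : ℝ) / 2 ^ h : ℝ))‖ ≤ 2 := by
        refine (norm_le_norm_add_norm_sub' _ E).trans ?_
        have h2 : ((i : ℝ) + 1) ≤ N := by
          have : i + 1 ≤ N := by omega
          exact_mod_cast this
        have : 82 * ((i : ℝ) + 1) * (1 / 2 ^ W) ≤ 82 * (N : ℝ) * (1 / 2 ^ W) := by gcongr
        linarith
      rwa [norm_mul, hexp, mul_one] at h1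
    obtain ⟨bC', bS'⟩ := bits_le_of_norm_le hF2
    have bA : bits A ≤ W := (bits_le.2 (by rwa [abs_of_nonneg hA])).trans heW
    have bhi : bits (A / 2 ^ (e - h)) ≤ W := (bits_ediv_le _ _).trans bA
    have bsh : bits (A / 2 ^ (e - h) * 2 ^ (e - h)) ≤ W :=
      (bits_nonneg_mono (by positivity) (Int.ediv_mul_le A hpd.ne')).trans bA
    have blo : bits (A - A / 2 ^ (e - h) * 2 ^ (e - h)) ≤ W :=
      (bits_nonneg_mono hlo (by linarith [mul_nonneg hhi hpd.le])).trans bA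
    have be : bits (e : ℤ) ≤ W := (bits_natCast_le e).trans heW
    have bh : bits (h : ℤ) ≤ W := (bits_natCast_le h).trans (by omega)
    have bd : bits ((e - h : ℕ) : ℤ) ≤ W := (bits_natCast_le _).trans (by omega)
    simp [hhz, hez]
    refine ⟨he1, ?_⟩
    refine Wp.call hexpI rfl le_rfl fun t₁ ht₁ => ?_
    simp [passCost, List.range, List.range.loop]
    refine Wp.call hmulI rfl le_rfl fun t₂ ht₂ => ?_
    simp [passCost, List.range, List.range.loop]
    refine (hI _ _ _).2 ⟨i + 1, h, A / 2 ^ (e - h), C', S', _, _, _, _, _, _, by omega, hh', hhi,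
      hhi', ?_, rfl, ?_⟩
    · push_cast
      push_cast at hnext
      linarith
    · have r₁ : 3000 * bits (W : ℤ) * L (10 * W) = 3000 * (bits (W : ℤ) * L (10 * W)) := by ring
      rw [r₁] at ht₁
      rw [mul_comm (L _) (bits _), mul_one] at hlamL
      rw [add_mul]
      generalize bits (W : ℤ) * L (10 * W) = X at *
      omega
  · intro τ t h
    obtain ⟨i, e, A, C, S, x₇, x₈, x₉, x₁₀, x₁₁, x₁₂, hij, he, hA, hA', herr, rfl, ht⟩ :=
      (hI _ _ _).1 h
    obtain rfl : i = N := by omega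
    have he0 : e = 0 := by
      rw [he]
      refine Nat.div_eq_of_lt ?_
      have := abs_lt_two_pow_bits (e₀ : ℤ)
      rw [abs_of_nonneg (by positivity), hNe] at this
      exact_mod_cast this
    subst he0
    obtain rfl : A = 0 := by
      rw [pow_zero] at hA'
      omega
    simp at herr ⊢
    exact hQ _ _ _ _ _ _ _ _ _ _ (by simpa using herr) (by omega)
  · refine (hI _ _ _).2 ⟨0, e₀, A₀, 2 ^ W, 0, 0, 0, 0, 0, 0, 0, by simp, by simp, hA₀, hA₀', ?_, rfl,
      by simp⟩
    have h1 : fixedComplex W (2 ^ W) 0 = 1 := by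
      apply Complex.ext <;> simp [fixedComplex, fixedPoint]
    rw [h1, one_mul, ← hE]
    simp

/-- The error of the bit bursts, after three squarings, is at most a quarter of a unit in the last of
the `3 * p` places. -/
theorem guard_bits_suffice {p N : ℕ} (hN : N ≤ p + 3) :
    27 * (82 * (N : ℝ) * (1 / 2 ^ (8 * p + 64))) + 26 * (1 / 2 ^ (8 * p + 64)) ≤
      1 / 4 * (1 / 2 ^ (3 * p)) := by
  have hP : (p : ℝ) + 1 ≤ 2 ^ p := by exact_mod_cast p.lt_two_pow_self
  have hN' : (N : ℝ) ≤ p + 3 := by exact_mod_cast hN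
  have e1 : (2 : ℝ) ^ (8 * p + 64) = (2 ^ p) ^ 8 * 2 ^ 64 := by rw [← pow_mul, ← pow_add]; ring_nf
  have e2 : (2 : ℝ) ^ (3 * p) = (2 ^ p) ^ 3 := by rw [← pow_mul]; ring_nf
  have hP1 : (1 : ℝ) ≤ 2 ^ p := one_le_pow₀ (by norm_num)
  rw [e1, e2]
  generalize (2 : ℝ) ^ p = P at *
  have hP0 : (0 : ℝ) < P := by linarith
  have h1 : 27 * (82 * (N : ℝ)) + 26 ≤ 2 ^ 62 * P := by norm_num; linarith
  have h2 : P * 1 ≤ P * P ^ 4 := by gcongr; exact one_le_pow₀ hP1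
  calc _ = (27 * (82 * (N : ℝ)) + 26) / (P ^ 8 * 2 ^ 64) := by ring
    _ ≤ (2 ^ 62 * (P * P ^ 4)) / (P ^ 8 * 2 ^ 64) := by gcongr; linarith
    _ = _ := by field_simp; norm_num

theorem exists_sineStep {mul : Prog} {L : ℕ → ℕ} (hmul : FastMul mul L) {p : ℕ} {a : ℤ}
    (ha : |Real.pi - fixedPoint p a| < 1) :
    ∃ b : ℤ, Computes (sineStep mul) [(p : ℤ), a] [b]
        (10000 * bits ((8 * p + 64 : ℕ) : ℤ) ^ 2 * L (10 * (8 * p + 64))) ∧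
      |fixedPoint (3 * p) b - (fixedPoint p a + Real.sin (fixedPoint p a))| ≤
        3 / 4 * (1 / 2 ^ (3 * p)) := by
  have hp0 : (0 : ℝ) < 2 ^ p := by positivity
  have hx : 0 < fixedPoint p a ∧ fixedPoint p a < 8 := by
    rw [abs_lt] at ha
    have := Real.pi_gt_three
    have := Real.pi_lt_four
    constructor <;> linarith
  have ha0 : 0 ≤ a := by
    have := (div_pos_iff_of_pos_right hp0).1 hx.1
    exact_mod_cast this.le
  have ha8 : a < 2 ^ (p + 3) := by
    have := (div_lt_iff₀ hp0).1 hx.2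
    rw [pow_add]
    have : (a : ℝ) < 2 ^ p * 2 ^ 3 := by linarith
    exact_mod_cast this
  have hNle := bits_natCast_le (p + 3)
  have hguard := guard_bits_suffice hNle
  have hlam0 : bits ((p + 3 : ℕ) : ℤ) ≤ bits ((8 * p + 64 : ℕ) : ℤ) :=
    bits_natCast_mono (by omega)
  have hp3 : (1 : ℝ) / 2 ^ (3 * p) ≤ 1 := by
    rw [div_le_one (by positivity)]; exact one_le_pow₀ (by norm_num)
  obtain ⟨W, hW⟩ : ∃ W, 8 * p + 64 = W := ⟨_, rfl⟩
  obtain ⟨e, he⟩ : ∃ e, p + 3 = e := ⟨_, rfl⟩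
  obtain ⟨g, hg⟩ : ∃ g, 5 * p + 64 = g := ⟨_, rfl⟩
  obtain ⟨d, hd⟩ : ∃ d, 2 * p = d := ⟨_, rfl⟩
  obtain ⟨k, hk⟩ : ∃ k, g - 1 = k := ⟨_, rfl⟩
  have hWz : (p : ℤ) * 8 + 64 = (W : ℤ) := by omega
  have hez : (p : ℤ) + 3 = (e : ℤ) := by omega
  have hdz : (p : ℤ) + p = (d : ℤ) := by omega
  have hgz : (W : ℤ) - d - p = (g : ℤ) := by omega
  have hkz : (g : ℤ) - 1 = (k : ℤ) := by omega
  rw [hW] at hguard hlam0 ⊢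
  rw [he] at hguard hlam0 hNle ha8
  have hε : (0 : ℝ) < 1 / 2 ^ W := by positivity
  have hη : (0 : ℝ) ≤ 82 * (bits (e : ℤ) : ℝ) * (1 / 2 ^ W) := by positivity
  have hL := hmul.le_self (10 * W)
  have hlam : 1 ≤ bits (W : ℤ) := one_le_bits (by omega)
  have hbW := bits_natCast_le W
  have hexp : ∀ x : ℝ, ‖Complex.exp (Complex.I * (x : ℂ))‖ = 1 := fun x => by
    rw [mul_comm]; exact Complex.norm_exp_ofReal_mul_I x
  obtain ⟨E, hE⟩ : ∃ E, E = Complex.exp (Complex.I * ((a : ℝ) / 2 ^ e : ℝ)) := ⟨_, rfl⟩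
  have hE1 : ‖E‖ = 1 := hE ▸ hexp _
  have hE2 : ‖E * E‖ = 1 := by rw [norm_mul, hE1, one_mul]
  have hE4 : ‖E * E * (E * E)‖ = 1 := by rw [norm_mul, hE2, one_mul]
  have hsin : (E * E * (E * E) * (E * E * (E * E))).im = Real.sin (fixedPoint p a) := by
    have h1 : E * E * (E * E) * (E * E * (E * E)) =
        Complex.exp ((fixedPoint p a : ℝ) * Complex.I) := by
      rw [hE]
      simp only [← Complex.exp_add, ← mul_add, ← Complex.ofReal_add]
      rw [mul_comm]
      congr 3
      rw [fixedPoint, ← he, pow_add]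
      field_simp
      norm_num
    rw [h1, Complex.exp_ofReal_mul_I_im]
  have hnorm : ∀ {F K : ℂ} {η : ℝ}, ‖K‖ = 1 → ‖F - K‖ ≤ η → η ≤ 1 → ‖F‖ ≤ 2 := by
    intro F K η h1 h2 h3
    have := norm_le_norm_add_norm_sub' F K
    linarith
  suffices key : ∀ s, Wp s (sineStep mul) (frame [(p : ℤ), a]) 0 fun τ t =>
      t ≤ 10000 * bits (W : ℤ) ^ 2 * L (10 * W) ∧
      |fixedPoint (3 * p) (τ 0) - (fixedPoint p a + Real.sin (fixedPoint p a))| ≤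
        3 / 4 * (1 / 2 ^ (3 * p)) by
    obtain ⟨τ, t, h1, h2, h3⟩ := key (sineStep mul)
    refine ⟨τ 0, ⟨τ, t, h1, by omega, fun i hi => ?_⟩, h3⟩
    obtain rfl : i = 0 := by simpa using hi
    rfl
  intro s
  rw [frame_pad _ 12]
  simp [sineStep, hWz, hez]
  refine wp_burstLoop (W := W) (e₀ := e) hmul (by omega) (by omega) ha0 ha8 (by linarith)
    fun C S x₇ x₈ x₉ x₁₀ x₁₁ x₁₂ x₁₃ t herr ht => ?_
  rw [← hE] at herr
  have hF := hnorm hE1 herr (by linarith)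
  obtain ⟨C₁, S₁, hc₁, he₁⟩ := exists_truncMul hmul (by omega : 1 ≤ W) hF hF
  replace he₁ := norm_square_le hE1 herr (by linarith) he₁
  have hF₁ := hnorm hE2 he₁ (by linarith)
  obtain ⟨C₂, S₂, hc₂, he₂⟩ := exists_truncMul hmul (by omega : 1 ≤ W) hF₁ hF₁
  replace he₂ := norm_square_le hE2 he₁ (by linarith) he₂
  have hF₂ := hnorm hE4 he₂ (by linarith)
  obtain ⟨C₃, S₃, hc₃, he₃⟩ := exists_truncMul hmul (by omega : 1 ≤ W) hF₂ hF₂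
  replace he₃ := norm_square_le hE4 he₂ (by linarith) he₃
  have hF₃ := hnorm (by rw [norm_mul, hE4, one_mul]) he₃ (by linarith)
  have hS : |fixedPoint (3 * p + g) S₃ - Real.sin (fixedPoint p a)| ≤
      1 / 4 * (1 / 2 ^ (3 * p)) := by
    rw [show 3 * p + g = W by omega, ← hsin]
    refine (Complex.abs_im_le_norm (fixedComplex W C₃ S₃ - _)).trans (he₃.trans ?_)
    linarith
  have hround := abs_round_sub_le (a := a) (by omega : 1 ≤ g) hS
  rw [hd, hk] at hround
  obtain ⟨bC, bS⟩ := bits_le_of_norm_le hF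
  obtain ⟨bC₁, bS₁⟩ := bits_le_of_norm_le hF₁
  obtain ⟨bC₂, bS₂⟩ := bits_le_of_norm_le hF₂
  obtain ⟨bC₃, bS₃⟩ := bits_le_of_norm_le hF₃
  refine Wp.call hc₁ rfl le_rfl fun t₁ ht₁ => ?_
  simp [passCost, List.range, List.range.loop]
  refine Wp.call hc₂ rfl le_rfl fun t₂ ht₂ => ?_
  simp [passCost, List.range, List.range.loop]
  refine Wp.call hc₃ rfl le_rfl fun t₃ ht₃ => ?_
  simp [passCost, List.range, List.range.loop, hdz, hgz, hkz]
  refine ⟨?_, by simpa using hround⟩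
  have bp : bits (p : ℤ) ≤ W := (bits_natCast_le p).trans (by omega)
  have be : bits (e : ℤ) ≤ W := (bits_natCast_le e).trans (by omega)
  have bd : bits (d : ℤ) ≤ W := (bits_natCast_le d).trans (by omega)
  have bg : bits (g : ℤ) ≤ W := (bits_natCast_le g).trans (by omega)
  have bk : bits (k : ℤ) ≤ W := (bits_natCast_le k).trans (by omega)
  have ba : bits a ≤ W := (bits_le.2 (by rwa [abs_of_nonneg ha0])).trans (by omega)
  have b2k : bits (2 ^ k) ≤ W := (bits_pow_two_le k).trans (by omega)
  have b2W := bits_pow_two_le W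
  have bsum : bits (S₃ + 2 ^ k) ≤ W + 3 := bits_add_le bS₃ (by omega)
  have bquo := bits_ediv_le (S₃ + 2 ^ k) g
  have bad := bits_mul_two_pow_le a d
  have b3 : bits 3 = 2 := by decide
  have b64 : bits 64 = 7 := by decide
  have bp8 : bits ((p : ℤ) * 8) ≤ bits (p : ℤ) + 3 := bits_mul_two_pow_le (p : ℤ) 3
  have bWd : bits ((W : ℤ) - d) ≤ W := (bits_nonneg_mono (by omega) (by omega)).trans hbW
  have z₁ : bits (e : ℤ) * (3200 * (bits (W : ℤ) * L (10 * W))) ≤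
      bits (W : ℤ) * (3200 * (bits (W : ℤ) * L (10 * W))) := Nat.mul_le_mul_right _ hlam0
  have z₂ : 1 * L (10 * W) ≤ bits (W : ℤ) ^ 2 * L (10 * W) :=
    Nat.mul_le_mul_right _ (Nat.one_le_pow _ _ hlam)
  have z₃ : bits (W : ℤ) * (3200 * (bits (W : ℤ) * L (10 * W))) =
      3200 * (bits (W : ℤ) ^ 2 * L (10 * W)) := by ring
  rw [mul_assoc 10000]
  generalize bits (W : ℤ) ^ 2 * L (10 * W) = Z at *
  omega

/-! ### The self-correcting iteration -/

/-- `π` is a fixed point of order three of `x ↦ x + sin x`. -/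
theorem abs_pi_sub_add_sin_le (x : ℝ) :
    |Real.pi - (x + Real.sin x)| ≤ |Real.pi - x| ^ 3 / 6 := by
  rw [← Real.sin_pi_sub x, ← sub_sub]
  generalize Real.pi - x = d at *
  wlog hd : 0 ≤ d generalizing d
  · have := this (-d) (by linarith)
    rwa [Real.sin_neg, abs_neg, show -d - -Real.sin d = -(d - Real.sin d) by ring, abs_neg] at this
  rcases hd.eq_or_lt with rfl | hd
  · simp
  · rw [abs_of_pos hd]
    have h1 := Real.sin_lt hd
    have h2 := Real.sin_gt_sub_cube hd
    rw [abs_of_pos (by linarith)]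
    linarith

theorem abs_pi_sub_lt_of_step {p : ℕ} {a b : ℤ} (ha : |Real.pi - fixedPoint p a| < 1 / 2 ^ p)
    (hb : |fixedPoint (3 * p) b - (fixedPoint p a + Real.sin (fixedPoint p a))| ≤
      3 / 4 * (1 / 2 ^ (3 * p))) :
    |Real.pi - fixedPoint (3 * p) b| < 1 / 2 ^ (3 * p) := by
  have h2 := abs_pi_sub_add_sin_le (fixedPoint p a)
  have h3 : |Real.pi - fixedPoint p a| ^ 3 < (1 / 2 ^ p) ^ 3 :=
    pow_lt_pow_left₀ ha (abs_nonneg _) (by norm_num)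
  rw [one_div_pow, ← pow_mul, mul_comm p 3] at h3
  have h4 := abs_sub_le Real.pi (fixedPoint p a + Real.sin (fixedPoint p a)) (fixedPoint (3 * p) b)
  rw [abs_sub_comm (fixedPoint p a + _)] at h4
  have h5 : (0 : ℝ) < 1 / 2 ^ (3 * p) := by positivity
  linarith

theorem bits_le_of_abs_pi_sub_lt {p : ℕ} {a : ℤ} (ha : |Real.pi - fixedPoint p a| < 1 / 2 ^ p) :
    bits a ≤ p + 3 := by
  have hp : (0 : ℝ) < 2 ^ p := by positivity
  have h1 : (1 : ℝ) / 2 ^ p ≤ 1 := by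
    rw [div_le_one (by positivity)]; exact one_le_pow₀ (by norm_num)
  have h2 : |fixedPoint p a| < 2 ^ 3 := by
    have := Real.pi_gt_three
    have := Real.pi_lt_four
    rw [abs_lt] at *
    constructor <;> linarith
  rw [fixedPoint, abs_div, abs_of_pos hp, div_lt_iff₀ hp, ← pow_add, add_comm] at h2
  rw [bits_le]
  exact_mod_cast h2

theorem Runs.computes {p : Prog} {ins : List ℤ} {out : ℤ} {t : ℕ} (h : Runs p ins out t) :
    Computes p ins [out] t := by
  obtain ⟨τ, h1, h2⟩ := h
  refine ⟨τ, t, h1, le_rfl, fun i hi => ?_⟩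
  obtain rfl : i = 0 := by simpa using hi
  simpa using h2

/-- `T p` bounds the running time of `step` on numbers with `p` fractional bits near `π`. -/
def StepTime (step : Prog) (T : ℕ → ℕ) : Prop :=
  ∀ (p : ℕ) (a b : ℤ) (t : ℕ), 1 ≤ p → |Real.pi - fixedPoint p a| < 1 →
    Runs step [(p : ℤ), a] b t → t ≤ T p

/-- Correctness of the iteration for an arbitrary implementation of the step, and its running time in
terms of that of the step. -/
theorem exists_runs_selfCorrectingPi {step : Prog} (hstep : IsSelfCorrectingStep step)
    (T : ℕ → ℕ) {n : ℕ} (hn : 1 ≤ n) :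
    ∃ (a : ℤ) (t : ℕ), Runs (selfCorrectingPi step) [(n : ℤ)] a t ∧
      |Real.pi - fixedPoint (3 ^ Nat.clog 3 n) a| < 1 / 2 ^ n ∧
      (StepTime step T → t ≤ ∑ k ∈ Finset.range (Nat.clog 3 n), T (3 ^ k) + 30 * n +
        100 * (Nat.clog 3 n + 1) * bits (n : ℤ)) := by
  obtain ⟨m, hm⟩ : ∃ m, Nat.clog 3 n = m := ⟨_, rfl⟩
  have hlt : ∀ i, i < m → 3 ^ i < n := fun i hi => by
    rw [← hm] at hi
    exact (Nat.lt_clog_iff_pow_lt (by norm_num)).1 hi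
  have hle : n ≤ 3 ^ m := by
    rw [← hm]
    exact Nat.le_pow_clog (by norm_num) n
  have hm3 : 3 ^ m ≤ 3 * n := by
    rcases Nat.eq_zero_or_pos m with h | h
    · rw [h]; omega
    · have := hlt (m - 1) (by omega)
      obtain ⟨k, rfl⟩ := Nat.exists_eq_add_of_le' h
      rw [Nat.add_sub_cancel] at this
      rw [pow_succ]
      omega
  have hsum : ∀ i, 2 * ∑ k ∈ Finset.range i, 3 ^ k + 1 = 3 ^ i := fun i => by
    induction i with
    | zero => rfl
    | succ i ih => rw [Finset.sum_range_succ, pow_succ]; omega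
  obtain ⟨β, hβ⟩ : ∃ β, bits (n : ℤ) = β := ⟨_, rfl⟩
  have hβ1 : 1 ≤ β := hβ ▸ one_le_bits hn
  rw [hm, hβ]
  suffices key : ∀ s, Wp s (selfCorrectingPi step) (frame [(n : ℤ)]) 0 fun τ t =>
      |Real.pi - fixedPoint (3 ^ m) (τ 0)| < 1 / 2 ^ n ∧
      (StepTime step T → t ≤ ∑ k ∈ Finset.range m, T (3 ^ k) + 30 * n + 100 * (m + 1) * β) by
    obtain ⟨τ, t, h1, h2, h3⟩ := key (selfCorrectingPi step)
    exact ⟨τ 0, t, ⟨τ, h1, rfl⟩, h2, by simpa using h3⟩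
  intro s
  rw [frame_pad _ 4]
  simp [selfCorrectingPi, hβ]
  -- the invariant is kept opaque, so that the simplifier does not take it apart
  obtain ⟨I, hI⟩ : ∃ I : ℕ → Mem → ℕ → Prop, ∀ j τ t, I j τ t ↔
      ∃ (i p : ℕ) (a x : ℤ), i + j = m ∧ p = 3 ^ i ∧ |Real.pi - fixedPoint p a| < 1 / 2 ^ p ∧
        τ = frame [(n : ℤ), (p : ℤ), a, (n : ℤ) - p, x] ∧
        (StepTime step T → t ≤ ∑ k ∈ Finset.range i, T (3 ^ k) +
          4 * ∑ k ∈ Finset.range i, 3 ^ k + 100 * i * β + 30 * β) :=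
    ⟨_, fun _ _ _ => Iff.rfl⟩
  refine Wp.loop I ?_ ?_ m _ _ ((hI _ _ _).2 ⟨0, 1, 6, 0, by simp, by simp, ?_, by simp, ?_⟩)
  · intro j τ t h
    obtain ⟨i, p, a, x, hij, hp, ha, rfl, ht⟩ := (hI _ _ _).1 h
    have hpn : p < n := hp ▸ hlt i (by omega)
    have hp1 : 1 ≤ p := hp ▸ Nat.one_le_pow _ _ (by norm_num)
    have ha1 : |Real.pi - fixedPoint p a| < 1 := ha.trans_le (by
      rw [div_le_one (by positivity)]; exact one_le_pow₀ (by norm_num))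
    obtain ⟨b, u, hrun, hb⟩ := hstep p hp1 a ha1
    have hb' := abs_pi_sub_lt_of_step ha hb
    have ba := bits_le_of_abs_pi_sub_lt ha
    have bb := bits_le_of_abs_pi_sub_lt hb'
    have small : ∀ z : ℤ, |z| ≤ 4 * n → bits z ≤ β + 2 := fun z hz => by
      rw [← hβ]
      refine (bits_mono ?_).trans (bits_mul_two_pow_le (n : ℤ) 2)
      rw [abs_of_nonneg (by positivity : (0 : ℤ) ≤ (n : ℤ) * 2 ^ 2)]
      linarith
    have s1 := small (p : ℤ) (by rw [abs_le]; constructor <;> omega)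
    have s2 := small ((p : ℤ) + p) (by rw [abs_le]; constructor <;> omega)
    have s3 := small ((p : ℤ) + p + p) (by rw [abs_le]; constructor <;> omega)
    have s4 := small ((n : ℤ) - p) (by rw [abs_le]; constructor <;> omega)
    simp
    refine ⟨hpn, ?_⟩
    refine Wp.call hrun.computes rfl le_rfl fun t₁ ht₁ => ?_
    simp [passCost, hβ]
    refine (hI _ _ _).2 ⟨i + 1, 3 * p, b, (p : ℤ) + p, by omega, by rw [hp, pow_succ]; ring, hb', ?_,
      fun hT => ?_⟩
    · push_cast
      rw [show (3 : ℤ) * p = p + p + p by ring]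
    · have h1 := ht hT
      have h2 := hT p a b u hp1 ha1 hrun
      rw [Finset.sum_range_succ, Finset.sum_range_succ, ← hp, mul_add, mul_add, add_mul]
      omega
  · intro τ t h
    obtain ⟨i, p, a, x, hij, rfl, ha, rfl, ht⟩ := (hI _ _ _).1 h
    obtain rfl : i = m := by omega
    have ba := bits_le_of_abs_pi_sub_lt ha
    simp
    refine ⟨by exact_mod_cast hle, ?_, fun hT => ?_⟩
    · refine ha.trans_le ?_
      simpa using one_div_pow_le_one_div_pow_of_le (a := (2 : ℝ)) (by norm_num) hle
    · have h1 := ht hT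
      have h2 := hsum i
      have h3 : bits ((n : ℤ) - 3 ^ i) ≤ 3 * n := by
        refine le_trans (bits_mono (y := ((3 * n : ℕ) : ℤ)) ?_) (bits_natCast_le (3 * n))
        have : (3 : ℤ) ^ i ≤ 3 * n := by exact_mod_cast hm3
        have : (0 : ℤ) < 3 ^ i := by positivity
        rw [abs_of_nonneg (by positivity : (0 : ℤ) ≤ ((3 * n : ℕ) : ℤ)), abs_le]
        push_cast
        constructor <;> omega
      rw [mul_add, add_mul]
      omega
  · have h1 := Real.pi_gt_three
    have h2 := Real.pi_lt_d2
    rw [abs_lt]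
    unfold fixedPoint
    norm_num
    constructor <;> linarith
  · intro _
    have : bits 6 = 3 := by decide
    simp
    omega

/-! ### The bit complexity -/

theorem Exec.pos {s p : Prog} {σ τ : Mem} {t : ℕ} (h : Exec s p σ τ t) : 0 < t := by
  induction h <;> omega

theorem multipliesNat_floor {mul : Prog} {M : ℕ → ℝ} (hmul : MultipliesWithin mul M) :
    MultipliesNat mul fun n => ⌊M n⌋₊ := by
  intro n hn a b ha ha' hb hb'
  lift a to ℕ using ha
  lift b to ℕ using hb
  obtain ⟨t, h1, h2⟩ := hmul n hn a b (by exact_mod_cast ha') (by exact_mod_cast hb')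
  exact h1.computes.mono (Nat.le_floor h2)

theorem one_le_of_multipliesWithin {mul : Prog} {M : ℕ → ℝ} (hmul : MultipliesWithin mul M)
    {n : ℕ} (hn : 1 ≤ n) : 1 ≤ M n := by
  obtain ⟨t, ⟨_, h1, _⟩, h2⟩ := hmul n hn 0 0 (by positivity) (by positivity)
  have : (1 : ℝ) ≤ t := by exact_mod_cast h1.pos
  exact this.trans h2

theorem sum_superadditive_le {F : ℕ → ℕ} (hF : ∀ a b, 1 ≤ a → 1 ≤ b → F a + F b ≤ F (a + b))
    (j : ℕ) : ∑ k ∈ Finset.range j, F (3 ^ k) ≤ F (3 ^ j) := by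
  induction j with
  | zero => simp
  | succ j ih =>
    have h0 : 1 ≤ 3 ^ j := Nat.one_le_pow _ _ (by norm_num)
    have h1 := hF (3 ^ j) (3 ^ j) h0 h0
    have h2 := hF (3 ^ j + 3 ^ j) (3 ^ j) (by omega) h0
    rw [show 3 ^ j + 3 ^ j + 3 ^ j = 3 ^ (j + 1) by ring] at h2
    rw [Finset.sum_range_succ]
    omega

theorem bits_le_log {n : ℕ} (hn : 2 ≤ n) : (bits (n : ℤ) : ℝ) ≤ 4 * Real.log n := by
  have h1 := two_pow_bits_le (show 1 ≤ n by omega)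
  have h2 := one_le_bits (show 1 ≤ n by omega)
  have h3 : ((bits (n : ℤ) - 1 : ℕ) : ℝ) * Real.log 2 ≤ Real.log n := by
    rw [← Real.log_pow]
    exact Real.log_le_log (by positivity) (by exact_mod_cast h1)
  have h4 : Real.log 2 ≤ Real.log n := Real.log_le_log (by norm_num) (by exact_mod_cast hn)
  have h5 := Real.log_two_gt_d9
  rw [Nat.cast_sub h2] at h3
  push_cast at h3
  have h6 : (1 : ℝ) ≤ bits (n : ℤ) := by exact_mod_cast h2
  nlinarith

end BitRAM

theorem theorem2 (mul : BitRAM.Prog) (M : ℕ → ℝ) (hmul : BitRAM.MultipliesWithin mul M)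
    (hM : ∀ a b : ℕ, 1 ≤ a → 1 ≤ b → M a + M b ≤ M (a + b)) :
    (∀ step : BitRAM.Prog, BitRAM.IsSelfCorrectingStep step →
      ∀ n : ℕ, 1 ≤ n → ∃ (a : ℤ) (t : ℕ),
        BitRAM.Runs (BitRAM.selfCorrectingPi step) [(n : ℤ)] a t ∧
        |Real.pi - BitRAM.fixedPoint (3 ^ Nat.clog 3 n) a| < 1 / 2 ^ n) ∧
    (∃ step : BitRAM.Prog, BitRAM.IsSelfCorrectingStep step ∧
      ∃ C : ℝ, ∀ n : ℕ, 2 ≤ n → ∃ (a : ℤ) (t : ℕ),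
        BitRAM.Runs (BitRAM.selfCorrectingPi step) [(n : ℤ)] a t ∧
        |Real.pi - BitRAM.fixedPoint (3 ^ Nat.clog 3 n) a| < 1 / 2 ^ n ∧
        (t : ℝ) ≤ C * (M n * Real.log n ^ 2)) := by
  refine ⟨fun step hstep n hn => ?_, ?_⟩
  · obtain ⟨a, t, h1, h2, -⟩ := BitRAM.exists_runs_selfCorrectingPi hstep (fun _ => 0) hn
    exact ⟨a, t, h1, h2⟩
  obtain ⟨F, hFdef⟩ : ∃ F : ℕ → ℕ, ∀ n, F n = ⌊M n⌋₊ := ⟨_, fun _ => rfl⟩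
  have hM1 : ∀ n, 1 ≤ n → 1 ≤ M n := fun n hn => BitRAM.one_le_of_multipliesWithin hmul hn
  have hFM : ∀ n, 1 ≤ n → (F n : ℝ) ≤ M n := fun n hn => by
    rw [hFdef]
    exact Nat.floor_le (zero_le_one.trans (hM1 n hn))
  have hF : ∀ a b, 1 ≤ a → 1 ≤ b → F a + F b ≤ F (a + b) := fun a b ha hb => by
    rw [hFdef (a + b)]
    refine Nat.le_floor ?_
    push_cast
    linarith [hFM a ha, hFM b hb, hM a b ha hb]
  have hF1 : ∀ n, 1 ≤ n → 1 ≤ F n := fun n hn => by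
    rw [hFdef]
    exact Nat.le_floor (by exact_mod_cast hM1 n hn)
  have hFn : ∀ n, 1 ≤ n → n ≤ F n := fun n hn => by
    induction n, hn using Nat.le_induction with
    | base => exact hF1 1 le_rfl
    | succ n hn ih => have := hF n 1 hn le_rfl; have := hF1 1 le_rfl; omega
  have hFmono : ∀ a b, 1 ≤ a → a ≤ b → F a ≤ F b := fun a b ha hab => by
    rcases hab.eq_or_lt with rfl | h
    · rfl
    · have := hF a (b - a) ha (by omega)
      rw [show a + (b - a) = b by omega] at this
      omega
  have hmulF : BitRAM.MultipliesNat mul F := by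
    rw [show F = fun n => ⌊M n⌋₊ from funext hFdef]
    exact BitRAM.multipliesNat_floor hmul
  -- the step multiplies numbers of up to `10 * (8 * p + 64) ≤ 2 ^ 10 * p` bits
  obtain ⟨mul', A, hfast⟩ := BitRAM.exists_fastMul hmulF hF 10
  set L : ℕ → ℕ := fun s => A * ((if s / 2 ^ 10 = 0 then 0 else F (s / 2 ^ 10)) + s) with hL
  have hLp : ∀ p, 1 ≤ p → L (10 * (8 * p + 64)) ≤ 1025 * A * F p := fun p hp => by
    refine (hfast.mono (show 10 * (8 * p + 64) ≤ 1024 * p by omega)).trans ?_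
    have h1 : 1024 * p / 2 ^ 10 = p := by norm_num
    have h2 := hFn p hp
    rw [hL]
    simp only [h1]
    rw [if_neg (by omega)]
    calc _ ≤ A * (F p + 1024 * F p) := by gcongr
      _ = _ := by ring
  clear_value L
  have hstep : BitRAM.IsSelfCorrectingStep (BitRAM.sineStep mul') := fun p _ a ha => by
    obtain ⟨b, ⟨τ, t, h1, -, h3⟩, h4⟩ := BitRAM.exists_sineStep hfast ha
    exact ⟨b, t, ⟨τ, h1, h3 0 (by simp)⟩, h4⟩
  refine ⟨BitRAM.sineStep mul', hstep, 16 * (2 * (656000000 * A : ℕ) + 230 : ℕ), fun n hn => ?_⟩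
  have htime : BitRAM.StepTime (BitRAM.sineStep mul') fun p =>
      10000 * BitRAM.bits ((8 * p + 64 : ℕ) : ℤ) ^ 2 * (1025 * A * F p) := by
    rintro p a b t hp ha ⟨τ, hτ, -⟩
    obtain ⟨b', ⟨τ', t', h1, h2, -⟩, -⟩ := BitRAM.exists_sineStep hfast ha
    rw [(hτ.unique h1).2]
    exact h2.trans (Nat.mul_le_mul_left _ (hLp p hp))
  obtain ⟨a, t, h1, h2, h3⟩ := BitRAM.exists_runs_selfCorrectingPi hstep _ (show 1 ≤ n by omega)
  refine ⟨a, t, h1, h2, ?_⟩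
  replace h3 := h3 htime
  have hlog := BitRAM.bits_le_log hn
  have hm : Nat.clog 3 n ≤ n := Nat.clog_le_of_le_pow (Nat.lt_pow_self (by norm_num)).le
  have hm0 : 0 < Nat.clog 3 n := Nat.clog_pos (by norm_num) hn
  have hlt : ∀ k < Nat.clog 3 n, 3 ^ k < n := fun k hk => Nat.pow_lt_of_lt_clog hk
  have hβ : 1 ≤ BitRAM.bits (n : ℤ) := BitRAM.one_le_bits (by omega)
  have h8 : ∀ p, p < n → BitRAM.bits ((8 * p + 64 : ℕ) : ℤ) ≤ 8 * BitRAM.bits (n : ℤ) := by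
    intro p hp
    have e1 := BitRAM.bits_mul_two_pow_le (n : ℤ) 7
    have e2 : BitRAM.bits ((8 * p + 64 : ℕ) : ℤ) ≤ BitRAM.bits ((n : ℤ) * 2 ^ 7) :=
      BitRAM.bits_nonneg_mono (by positivity) (by push_cast; omega)
    omega
  generalize Nat.clog 3 n = m at *
  generalize BitRAM.bits (n : ℤ) = β at *
  have hsumF : ∑ k ∈ Finset.range m, F (3 ^ k) ≤ 2 * F n := by
    obtain ⟨m, rfl⟩ := Nat.exists_eq_add_of_le' hm0
    rw [Finset.sum_range_succ]
    have e1 := BitRAM.sum_superadditive_le hF m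
    have e2 := hFmono (3 ^ m) n (Nat.one_le_pow _ _ (by norm_num)) (hlt m (by omega)).le
    omega
  have hsum : ∑ k ∈ Finset.range m,
      10000 * BitRAM.bits ((8 * 3 ^ k + 64 : ℕ) : ℤ) ^ 2 * (1025 * A * F (3 ^ k)) ≤
      656000000 * A * β ^ 2 * (2 * F n) := by
    calc _ ≤ ∑ k ∈ Finset.range m, 656000000 * A * β ^ 2 * F (3 ^ k) := by
          refine Finset.sum_le_sum fun k hk => ?_
          have := h8 _ (hlt k (Finset.mem_range.1 hk))
          calc _ ≤ 10000 * (8 * β) ^ 2 * (1025 * A * F (3 ^ k)) := by gcongr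
            _ = _ := by ring
      _ ≤ _ := by
        rw [← Finset.mul_sum]
        gcongr
  have hFn' := hFn n (by omega)
  have hββ : β ≤ β ^ 2 := Nat.le_self_pow (by norm_num) β
  have hn2 : n ≤ β ^ 2 * F n := hFn'.trans (Nat.le_mul_of_pos_left _ (by positivity))
  have hmβ : (m + 1) * β ≤ 2 * (β ^ 2 * F n) := by
    calc (m + 1) * β ≤ (2 * F n) * β ^ 2 := by gcongr; omega
      _ = _ := by ring
  have total : t ≤ (2 * (656000000 * A) + 230) * (β ^ 2 * F n) := by
    have e : (2 * (656000000 * A) + 230) * (β ^ 2 * F n) =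
        656000000 * A * β ^ 2 * (2 * F n) + 230 * (β ^ 2 * F n) := by ring
    rw [e]
    rw [mul_assoc] at h3
    omega
  have hβlog : (β : ℝ) ^ 2 ≤ (4 * Real.log n) ^ 2 := pow_le_pow_left₀ (by positivity) hlog 2
  have hMn := hFM n (by omega)
  generalize 2 * (656000000 * A) + 230 = K at *
  calc (t : ℝ) ≤ (K : ℝ) * ((β : ℝ) ^ 2 * F n) := by exact_mod_cast total
    _ ≤ (K : ℝ) * ((4 * Real.log n) ^ 2 * M n) := by gcongr
    _ = _ := by ring
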